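/- A metric graph $\mathcal G$ is given by a finite or countably infinite set $E$ of edges $e$ with lengths $\ell_e\in(0,\infty)$ and an equivalence relation on the endpoints of the intervals $[0,\ell_e]$; $\mathcal G$ is the corresponding quotient of $\bigsqcup_{e\in E}[0,\ell_e]$, with the path metric $\mathrm{dist}$ (loops and parallel edges are allowed). It is locally finite if every vertex is an endpoint of only finitely many edges, and connected if all distances are finite. Its length is $L=\sum_{e}\ell_e$, its diameter is $D=\sup_{x,y\in\mathcal G}\mathrm{dist}(x,y)$, and its first Betti number $\beta$ is the number of independent cycles, i.e. the dimension of the cycle space of $\mathcal G$. Let $H^1(\mathcal G)$ be the space of continuous $f:\mathcal G\to\mathbb R$ that are absolutely continuous on every edge and satisfy $\sum_{e}\int_0^{\ell_e}(|f|^2+|f'|^2)\,dx<\infty$. The Neumann extension $\mathcal H_{\mathrm N}$ is the self-adjoint operator on $L^2(\mathcal G)$ associated with the quadratic form $f\mapsto\int_{\mathcal G}|f'|^2\,dx$ with domain $H^1(\mathcal G)$: one has $f\in\mathrm{dom}(\mathcal H_{\mathrm N})$ and $\mathcal H_{\mathrm N}f=g$ if and only if $f\in H^1(\mathcal G)$,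 $g\in L^2(\mathcal G)$ and $\int_{\mathcal G}f'v'\,dx=\int_{\mathcal G}gv\,dx$ for all $v\in H^1(\mathcal G)$. Let $\mu_1(\mathcal G)\le\mu_2(\mathcal G)\le\dots$ be its eigenvalues, repeated according to multiplicity (when $L<\infty$ the spectrum is purely discrete). **Proposition.** Let $\mathcal G$ be a locally finite, connected metric graph with finite length $L>0$, finite diameter $D>0$ and finite first Betti number $\beta\in\mathbb N_0$. Then the second eigenvalue $\mu_2(\mathcal G)$ of $\mathcal H_{\mathrm N}$ exists and satisfies $$\mu_2(\mathcal G)\ \le\ \frac{\pi^2}{D^2}\cdot\frac{4L-3D}{D}.$$ -/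

import Mathlib

open MeasureTheory Set
open scoped ENNReal

noncomputable section

/-- A metric graph with edge set `E`: edge lengths in `(0, ∞)` and an equivalence relation on the
set of endpoints of the edges. The endpoint `(e, false)` is the point `0` and `(e, true)` is the
point `len e` of the interval `[0, len e]`. Loops and parallel edges are allowed. -/
structure MetricGraph (E : Type*) where
  len : E → ℝ
  len_pos : ∀ e, 0 < len e
  glue : Setoid (E × Bool)

namespace MetricGraph

variable {E : Type*} (G : MetricGraph E)

/-- The vertices: classes of identified endpoints. -/
def Vertex : Type _ := Quotient G.glue

/-- The vertex at an endpoint of an edge. -/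
def vertexAt (s : E × Bool) : G.Vertex := Quotient.mk G.glue s

/-- The disjoint union of the intervals `[0, len e]`. -/
def Seg : Type _ := {a : E × ℝ // a.2 ∈ Icc 0 (G.len a.1)}

/-- An endpoint of an edge as an element of the disjoint union. -/
def endpoint (s : E × Bool) : G.Seg :=
  ⟨(s.1, if s.2 then G.len s.1 else 0), by
    have h := (G.len_pos s.1).le
    constructor <;> (split_ifs <;> simp [h])⟩

theorem endpoint_injective : Function.Injective G.endpoint := by
  rintro ⟨e, b⟩ ⟨f, c⟩ h
  have h' := congrArg Subtype.val h
  simp only [endpoint, Prod.mk.injEq] at h'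
  obtain ⟨rfl, h2⟩ := h'
  have hp := (G.len_pos e).ne'
  cases b <;> cases c <;> simp_all

/-- The extension of the equivalence relation to the disjoint union of the edges. -/
def segSetoid : Setoid G.Seg where
  r a b := a = b ∨ ∃ s t, G.glue s t ∧ a = G.endpoint s ∧ b = G.endpoint t
  iseqv :=
    { refl := fun _ => Or.inl rfl
      symm := by
        rintro a b (rfl | ⟨s, t, h, rfl, rfl⟩)
        · exact Or.inl rfl
        · exact Or.inr ⟨t, s, G.glue.symm h, rfl, rfl⟩
      trans := by
        rintro a b c (rfl | ⟨s, t, h, rfl, rfl⟩) (rfl | ⟨s', t', h', h1, rfl⟩)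
        · exact Or.inl rfl
        · exact Or.inr ⟨s', t', h', h1, rfl⟩
        · exact Or.inr ⟨s, t, h, rfl, rfl⟩
        · have := G.endpoint_injective h1
          subst this
          exact Or.inr ⟨s, t', G.glue.trans h h', rfl, rfl⟩ }

/-- The points of the metric graph: the quotient of the disjoint union of the edges. -/
def Pt : Type _ := Quotient G.segSetoid

/-- The quotient map. -/
def proj (a : G.Seg) : G.Pt := Quotient.mk G.segSetoid a

/-- The distance on the disjoint union: `|x - y|` on a common edge, and `∞` otherwise. -/
def segDist (a b : G.Seg) : ℝ≥0∞ :=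
  open Classical in if a.1.1 = b.1.1 then ENNReal.ofReal |a.1.2 - b.1.2| else ⊤

/-- `(ξ 0, θ 0), …, (ξ n, θ n)` is a chain of pairs in the disjoint union that leads from `p` to
`q`: `θ i` and `ξ (i + 1)` are the same point of the graph. -/
def IsChain (p q : G.Pt) (n : ℕ) (ξ θ : ℕ → G.Seg) : Prop :=
  G.proj (ξ 0) = p ∧ G.proj (θ n) = q ∧ ∀ i < n, G.proj (θ i) = G.proj (ξ (i + 1))

/-- The distance on the graph: the infimum of the lengths of all chains from `p` to `q`. -/
def gdist (p q : G.Pt) : ℝ≥0∞ :=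
  ⨅ (n : ℕ) (ξ : ℕ → G.Seg) (θ : ℕ → G.Seg) (_ : G.IsChain p q n ξ θ),
    ∑ i ∈ Finset.range (n + 1), G.segDist (ξ i) (θ i)

theorem gdist_le {p q : G.Pt} {n : ℕ} {ξ θ : ℕ → G.Seg} (h : G.IsChain p q n ξ θ) :
    G.gdist p q ≤ ∑ i ∈ Finset.range (n + 1), G.segDist (ξ i) (θ i) :=
  iInf_le_of_le n (iInf_le_of_le ξ (iInf_le_of_le θ (iInf_le_of_le h le_rfl)))

theorem le_gdist {p q : G.Pt} {c : ℝ≥0∞}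
    (h : ∀ n ξ θ, G.IsChain p q n ξ θ →
      c ≤ ∑ i ∈ Finset.range (n + 1), G.segDist (ξ i) (θ i)) : c ≤ G.gdist p q :=
  le_iInf fun n => le_iInf fun ξ => le_iInf fun θ => le_iInf fun hc => h n ξ θ hc

theorem segDist_self (a : G.Seg) : G.segDist a a = 0 := by simp [segDist]

theorem segDist_comm (a b : G.Seg) : G.segDist a b = G.segDist b a := by
  unfold segDist
  rw [abs_sub_comm]
  by_cases h : a.1.1 = b.1.1
  · rw [if_pos h, if_pos h.symm]
  · rw [if_neg h, if_neg (Ne.symm h)]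

theorem gdist_self (p : G.Pt) : G.gdist p p = 0 := by
  obtain ⟨a, rfl⟩ : ∃ a, G.proj a = p := Quotient.exists_rep p
  have := G.gdist_le (p := G.proj a) (q := G.proj a) (n := 0) (ξ := fun _ => a) (θ := fun _ => a)
    ⟨rfl, rfl, by simp⟩
  simpa [segDist_self] using this

theorem gdist_comm_le (p q : G.Pt) : G.gdist p q ≤ G.gdist q p := by
  refine G.le_gdist fun n ξ θ ⟨h0, h1, h2⟩ => ?_
  refine (G.gdist_le (n := n) (ξ := fun i => θ (n - i)) (θ := fun i => ξ (n - i))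
    ⟨by simpa using h1, by simpa using h0, fun i hi => ?_⟩).trans_eq ?_
  · have := h2 (n - (i + 1)) (by omega)
    rw [show n - (i + 1) + 1 = n - i by omega] at this
    exact this.symm
  · rw [← Finset.sum_range_reflect (fun i => G.segDist (ξ i) (θ i)) (n + 1)]
    refine Finset.sum_congr rfl fun i _ => ?_
    rw [segDist_comm]
    congr 2

theorem gdist_triangle (p q r : G.Pt) : G.gdist p r ≤ G.gdist p q + G.gdist q r := by
  unfold gdist
  simp only [ENNReal.iInf_add, ENNReal.add_iInf]
  refine le_iInf fun n' => le_iInf fun ξ' => le_iInf fun θ' => le_iInf fun h' =>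
    le_iInf fun n => le_iInf fun ξ => le_iInf fun θ => le_iInf fun h => ?_
  obtain ⟨a0, a1, a2⟩ := h
  obtain ⟨b0, b1, b2⟩ := h'
  refine (G.gdist_le (n := n + 1 + n')
    (ξ := fun i => if i ≤ n then ξ i else ξ' (i - (n + 1)))
    (θ := fun i => if i ≤ n then θ i else θ' (i - (n + 1))) ⟨by simpa using a0, ?_, ?_⟩).trans_eq ?_
  · have : ¬ n + 1 + n' ≤ n := by omega
    simpa [this] using b1
  · intro i hi
    rcases lt_trichotomy i n with hin | hin | hin
    · simpa [hin.le, Nat.succ_le_of_lt hin] using a2 i hin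
    · subst hin
      simp [a1, b0]
    · have h1 : ¬ i ≤ n := by omega
      have h2 : ¬ i + 1 ≤ n := by omega
      have := b2 (i - (n + 1)) (by omega)
      simp only [h1, h2, if_false]
      rwa [show i - (n + 1) + 1 = i + 1 - (n + 1) by omega] at this
  · rw [show n + 1 + n' + 1 = (n + 1) + (n' + 1) by omega, Finset.sum_range_add]
    congr 1
    · refine Finset.sum_congr rfl fun i hi => ?_
      have : i ≤ n := by simpa [Nat.lt_succ_iff] using hi
      simp [this]
    · refine Finset.sum_congr rfl fun i _ => ?_
      have : ¬ n + 1 + i ≤ n := by omega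
      simp [this]

/-- The graph as a metric space with distances in `[0, ∞]`; it also carries the topology of this
metric. -/
instance : PseudoEMetricSpace G.Pt where
  edist := G.gdist
  edist_self := G.gdist_self
  edist_comm p q := le_antisymm (G.gdist_comm_le p q) (G.gdist_comm_le q p)
  edist_triangle := G.gdist_triangle

/-- Connectedness: any two points have finite distance. -/
def Connected : Prop := ∀ p q : G.Pt, edist p q < ⊤

/-- The degree of a vertex: the number of incident edges, loops counted twice. -/
def degree (v : G.Vertex) : ℕ∞ := {s : E × Bool | G.vertexAt s = v}.encard

/-- Local finiteness: all vertices have finite degree. -/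
def LocallyFinite : Prop := ∀ v : G.Vertex, G.degree v < ⊤

/-- The total length. -/
def totalLength : ℝ≥0∞ := ∑' e, ENNReal.ofReal (G.len e)

/-- The diameter: the supremum of the distances of all pairs of points. -/
def diam : ℝ≥0∞ := ⨆ (p : G.Pt) (q : G.Pt), edist p q

/-- The boundary map from 1-chains to 0-chains of the graph with rational coefficients. -/
def boundary : (E →₀ ℚ) →ₗ[ℚ] (G.Vertex →₀ ℚ) :=
  Finsupp.lmapDomain ℚ ℚ (fun e => G.vertexAt (e, true)) -
    Finsupp.lmapDomain ℚ ℚ (fun e => G.vertexAt (e, false))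

/-- The first Betti number: the number of independent cycles, that is, the dimension of the cycle
space (the first homology) of the graph. -/
def betti : ℕ∞ := Cardinal.toENat (Module.rank ℚ (LinearMap.ker G.boundary))

/-- The point of the graph at the coordinate `x ∈ [0, len e]` of the edge `e`; real numbers
outside of `[0, len e]` are first moved to the nearer endpoint. -/
def pt (e : E) (x : ℝ) : G.Pt :=
  G.proj ⟨(e, (projIcc 0 (G.len e) (G.len_pos e).le x : ℝ)),
    (projIcc 0 (G.len e) (G.len_pos e).le x).2⟩

/-- The restriction of a function on the graph to an edge, in the coordinate of the edge. -/
def onEdge (f : G.Pt → ℝ) (e : E) : ℝ → ℝ := fun x => f (G.pt e x)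

/-- `f` represents an element of `L²`, the space of families of `L²` functions on the edges with
a summable sequence of squared norms. -/
def MemL2 (f : G.Pt → ℝ) : Prop :=
  (∀ e, AEStronglyMeasurable (G.onEdge f e) (volume.restrict (Icc 0 (G.len e)))) ∧
    ∑' e, ∫⁻ x in Icc 0 (G.len e), ‖G.onEdge f e x‖ₑ ^ 2 < ⊤

/-- The inner product of `L²`. -/
def l2Inner (f g : G.Pt → ℝ) : ℝ :=
  ∑' e, ∫ x in (0 : ℝ)..G.len e, G.onEdge f e x * G.onEdge g e x

/-- `f` belongs to the Sobolev space `H¹` of the graph: it is continuous on the graph and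
absolutely continuous on every edge, and the squared `H¹` norms on the edges have a finite sum.
For an absolutely continuous function the distributional derivative is the derivative `deriv`,
which exists almost everywhere. -/
def MemH1 (f : G.Pt → ℝ) : Prop :=
  Continuous f ∧
    (∀ e, AbsolutelyContinuousOnInterval (G.onEdge f e) 0 (G.len e)) ∧
    ∑' e, ∫⁻ x in Icc 0 (G.len e),
      (‖G.onEdge f e x‖ₑ ^ 2 + ‖deriv (G.onEdge f e) x‖ₑ ^ 2) < ⊤

/-- The symmetric bilinear form `∫ f' g'` with domain `H¹`, whose quadratic form is the Neumann
form. -/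
def neumannForm (f g : G.Pt → ℝ) : ℝ :=
  ∑' e, ∫ x in (0 : ℝ)..G.len e, deriv (G.onEdge f e) x * deriv (G.onEdge g e) x

/-- The Neumann extension `H_N` of the Kirchhoff Laplacian, given by its graph: it is the operator
in `L²` that is associated with the Neumann form. So `f` is in its domain and `H_N f = g` if and
only if `f ∈ H¹`, `g ∈ L²` and `∫ f' v' = ∫ g v` for all `v ∈ H¹`. -/
def NeumannLaplacian (f g : G.Pt → ℝ) : Prop :=
  G.MemH1 f ∧ G.MemL2 g ∧ ∀ v, G.MemH1 v → G.neumannForm f v = G.l2Inner g v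

/-- `f` is an eigenfunction of `H_N` for the eigenvalue `μ`. -/
def IsNeumannEigenfunction (μ : ℝ) (f : G.Pt → ℝ) : Prop :=
  f ≠ 0 ∧ G.NeumannLaplacian f (μ • f)

/-- For `k ≥ 1`: `μ` is the `k`-th eigenvalue `μ_k` of `H_N` when the eigenvalues are put in
increasing order and repeated according to their multiplicities. It is the least real number `t`
such that there are `k` linearly independent eigenfunctions with eigenvalues at most `t`. -/
def IsNeumannEigenvalue (k : ℕ) (μ : ℝ) : Prop :=
  IsLeast {t : ℝ | ∃ ψ : Fin k → G.Pt → ℝ, LinearIndependent ℝ ψ ∧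
    ∀ i, ∃ ν ≤ t, G.IsNeumannEigenfunction ν (ψ i)} μ

end MetricGraph

end

open Filter Topology

/-! Take points `x`, `y` at distance `d > 0` and put `cos (π r / d)` on the balls of radius `d / 2`
about them, where `r` is the distance to the centre, extended by zero. The balls are disjoint, so
these two functions are orthogonal both in `L²` and in energy. If `c` is the squared norm of one of
them and `B` its ball, then `sin² = 1 - cos²` bounds its energy by `(π / d)² (|B| - c)`. By
connectedness every distance in `[0, d]` is attained, so the push-forward of length under `r`
dominates Lebesgue measure there (`volume_restrict_le_map_lift`). Hence `c ≥ d / 4`, and each ball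
has length at least `d / 2`, so disjointness gives `|B| ≤ L - d / 2`. The Rayleigh quotient is then
at most `(π / d)² (4 L - 3 d) / d` (`norm_sq_derivL2_testH1_le`). Some nonzero combination of the
two functions is orthogonal to constants, so the same bound holds for the minimum of the Rayleigh
quotient on that complement. The direct method shows that this minimum is attained and is the second
eigenvalue (`exists_isNeumannEigenvalue_two`); its ingredients are the compactness
`exists_subseq_cauchySeq_toL2` and the closedness `exists_tendsto_of_cauchySeq`. Finally `d` tends
to `D`. -/

theorem Sigma.measurableEmbedding_mk {ι : Type*} {β : Type*} [MeasurableSpace β] (i : ι) :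
    MeasurableEmbedding (fun x : β => (⟨i, x⟩ : (_ : ι) × β)) where
  injective x y h := by simpa using h
  measurable := Measurable.of_le_map (iInf_le _ i)
  measurableSet_image' := by
    intro s hs
    refine MeasurableSpace.measurableSet_iInf.2 fun j => ?_
    change MeasurableSet ((fun x : β => (⟨j, x⟩ : (_ : ι) × β)) ⁻¹' _)
    by_cases h : i = j
    · subst h
      rwa [preimage_image_eq]
      intro x y h
      simpa using h
    · convert MeasurableSet.empty
      ext x
      simp [h]

/-! ### The length measure, and `H¹` with its two maps into `L²` -/

namespace MetricGraph

variable {E : Type*} (G : MetricGraph E)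

/-- The length measure on the disjoint union of the edges. -/
noncomputable def meas : Measure ((_ : E) × ℝ) :=
  Measure.sum fun e => (volume.restrict (Icc 0 (G.len e))).map fun x => ⟨e, x⟩

theorem lintegral_meas (F : (_ : E) × ℝ → ℝ≥0∞) :
    ∫⁻ a, F a ∂G.meas = ∑' e, ∫⁻ x in Icc 0 (G.len e), F ⟨e, x⟩ := by
  rw [meas, lintegral_sum_measure]
  exact tsum_congr fun e => (Sigma.measurableEmbedding_mk e).lintegral_map _

theorem aestronglyMeasurable_meas [Countable E] {F : (_ : E) × ℝ → ℝ} :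
    AEStronglyMeasurable F G.meas ↔
      ∀ e, AEStronglyMeasurable (fun x => F ⟨e, x⟩) (volume.restrict (Icc 0 (G.len e))) := by
  rw [meas, aestronglyMeasurable_sum_measure_iff]
  exact forall_congr' fun e => (Sigma.measurableEmbedding_mk e).aestronglyMeasurable_map_iff

theorem ae_meas_iff [Countable E] {p : (_ : E) × ℝ → Prop} :
    (∀ᵐ a ∂G.meas, p a) ↔ ∀ e, ∀ᵐ x ∂volume.restrict (Icc 0 (G.len e)), p ⟨e, x⟩ := by
  rw [meas, Measure.ae_sum_iff]
  exact forall_congr' fun e => (Sigma.measurableEmbedding_mk e).ae_map_iff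

theorem integral_meas {F : (_ : E) × ℝ → ℝ} (hF : Integrable F G.meas) :
    ∫ a, F a ∂G.meas = ∑' e, ∫ x in (0 : ℝ)..G.len e, F ⟨e, x⟩ := by
  rw [meas] at hF ⊢
  rw [integral_sum_measure hF]
  refine tsum_congr fun e => ?_
  rw [(Sigma.measurableEmbedding_mk e).integral_map,
    intervalIntegral.integral_of_le (G.len_pos e).le, integral_Icc_eq_integral_Ioc]

theorem meas_univ : G.meas univ = G.totalLength := by
  rw [← lintegral_one, lintegral_meas, totalLength]
  simp

theorem map_mk_le_meas (e : E) :
    (volume.restrict (Icc 0 (G.len e))).map (fun x => (⟨e, x⟩ : (_ : E) × ℝ)) ≤ G.meas :=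
  Measure.le_sum _ e

/-- A function on the graph in the coordinates of the edges. -/
noncomputable def lift (f : G.Pt → ℝ) (a : (_ : E) × ℝ) : ℝ := G.onEdge f a.1 a.2

/-- The derivative of a function on the graph in the coordinates of the edges. -/
noncomputable def dlift (f : G.Pt → ℝ) (a : (_ : E) × ℝ) : ℝ := deriv (G.onEdge f a.1) a.2

theorem aestronglyMeasurable_dlift [Countable E] (f : G.Pt → ℝ) :
    AEStronglyMeasurable (G.dlift f) G.meas :=
  G.aestronglyMeasurable_meas.2 fun e => (measurable_deriv (G.onEdge f e)).aestronglyMeasurable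

theorem exists_pt_eq (p : G.Pt) : ∃ e, ∃ x ∈ Icc 0 (G.len e), G.pt e x = p := by
  obtain ⟨⟨⟨e, x⟩, hx⟩, rfl⟩ : ∃ a, G.proj a = p := Quotient.exists_rep p
  refine ⟨e, x, hx, ?_⟩
  simp only [pt]
  congr 3
  exact congrArg Subtype.val (projIcc_of_mem _ hx)

theorem pt_eq_proj {e : E} {x : ℝ} (hx : x ∈ Icc 0 (G.len e)) :
    G.pt e x = G.proj ⟨(e, x), hx⟩ := by
  simp only [pt]
  congr 3
  exact congrArg Subtype.val (projIcc_of_mem _ hx)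

theorem edist_pt_le (e : E) (x y : ℝ) : edist (G.pt e x) (G.pt e y) ≤ edist x y := by
  have h0 := (G.len_pos e).le
  refine (G.gdist_le (n := 0)
    (ξ := fun _ => ⟨(e, (projIcc 0 (G.len e) h0 x : ℝ)), (projIcc 0 (G.len e) h0 x).2⟩)
    (θ := fun _ => ⟨(e, (projIcc 0 (G.len e) h0 y : ℝ)), (projIcc 0 (G.len e) h0 y).2⟩)
    ⟨rfl, rfl, by simp⟩).trans ?_
  simp only [zero_add, Finset.range_one, segDist, if_true, Finset.sum_singleton]
  rw [edist_dist, Real.dist_eq]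
  exact ENNReal.ofReal_le_ofReal (abs_projIcc_sub_projIcc h0)

theorem continuous_pt (e : E) : Continuous (G.pt e) :=
  (LipschitzWith.of_edist_le (G.edist_pt_le e)).continuous

theorem _root_.MeasureTheory.memLp_two_iff_lintegral {α : Type*} {m : MeasurableSpace α}
    {μ : Measure α} {f : α → ℝ} (hf : AEStronglyMeasurable f μ) :
    MemLp f 2 μ ↔ ∫⁻ a, ‖f a‖ₑ ^ 2 ∂μ < ⊤ := by
  have := eLpNorm_lt_top_iff_lintegral_rpow_enorm_lt_top (μ := μ) (f := f) two_ne_zero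
    ENNReal.ofNat_ne_top
  simp only [ENNReal.toReal_ofNat, ENNReal.rpow_ofNat] at this
  rw [← this, MemLp, and_iff_right hf]

theorem aestronglyMeasurable_lift [Countable E] {f : G.Pt → ℝ} (hf : Continuous f) :
    AEStronglyMeasurable (G.lift f) G.meas :=
  G.aestronglyMeasurable_meas.2 fun e =>
    (hf.comp (G.continuous_pt e)).aestronglyMeasurable

/-- Replaces sums over edges by one measure, so that Hilbert space tools apply to functions and
derivatives alike. -/
theorem memH1_iff [Countable E] {f : G.Pt → ℝ} : G.MemH1 f ↔ Continuous f ∧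
    (∀ e, AbsolutelyContinuousOnInterval (G.onEdge f e) 0 (G.len e)) ∧
    MemLp (G.lift f) 2 G.meas ∧ MemLp (G.dlift f) 2 G.meas := by
  refine and_congr_right fun hc => and_congr_right fun _ => ?_
  rw [memLp_two_iff_lintegral (G.aestronglyMeasurable_lift hc),
    memLp_two_iff_lintegral (G.aestronglyMeasurable_dlift f), ← ENNReal.add_lt_top,
    ← lintegral_add_left' ((G.aestronglyMeasurable_lift hc).enorm.pow_const 2), lintegral_meas]
  rfl

theorem MemH1.memL2 [Countable E] {f : G.Pt → ℝ} (hf : G.MemH1 f) : G.MemL2 f := by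
  have h := G.memH1_iff.1 hf
  refine ⟨G.aestronglyMeasurable_meas.1 h.2.2.1.1, ?_⟩
  have := (memLp_two_iff_lintegral h.2.2.1.1).1 h.2.2.1
  rwa [lintegral_meas] at this

/-- `deriv` is additive only where both summands are differentiable; absolute continuity provides
this almost everywhere. -/
theorem dlift_add_ae [Countable E] {f g : G.Pt → ℝ}
    (hf : ∀ e, AbsolutelyContinuousOnInterval (G.onEdge f e) 0 (G.len e))
    (hg : ∀ e, AbsolutelyContinuousOnInterval (G.onEdge g e) 0 (G.len e)) :
    G.dlift (f + g) =ᵐ[G.meas] G.dlift f + G.dlift g := by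
  refine G.ae_meas_iff.2 fun e => (ae_restrict_iff' measurableSet_Icc).2 ?_
  filter_upwards [(hf e).ae_differentiableAt, (hg e).ae_differentiableAt] with x h1 h2 hx
  rw [← uIcc_of_le (G.len_pos e).le] at hx
  exact deriv_add (h1 hx) (h2 hx)

theorem dlift_smul (c : ℝ) (f : G.Pt → ℝ) : G.dlift (c • f) = c • G.dlift f := by
  funext a
  exact deriv_const_mul_field c

/-- The Sobolev space `H¹` as a space of functions. -/
def H1 [Countable E] : Submodule ℝ (G.Pt → ℝ) where
  carrier := {f | G.MemH1 f}
  zero_mem' := by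
    have h : G.onEdge 0 = fun _ _ => 0 := rfl
    refine ⟨continuous_zero, fun e => ?_, ?_⟩
    · rw [h]
      exact (LipschitzWith.const (0 : ℝ)).lipschitzOnWith.absolutelyContinuousOnInterval
    · simp [h]
  add_mem' := by
    intro f g hf hg
    have hf := G.memH1_iff.1 hf
    have hg := G.memH1_iff.1 hg
    refine G.memH1_iff.2 ⟨hf.1.add hg.1, fun e => (hf.2.1 e).add (hg.2.1 e), ?_, ?_⟩
    · exact hf.2.2.1.add hg.2.2.1
    · exact (memLp_congr_ae (G.dlift_add_ae hf.2.1 hg.2.1)).2 (hf.2.2.2.add hg.2.2.2)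
  smul_mem' := by
    intro c f hf
    have hf := G.memH1_iff.1 hf
    refine G.memH1_iff.2 ⟨hf.1.const_smul c, fun e => (hf.2.1 e).const_smul c, ?_, ?_⟩
    · exact hf.2.2.1.const_smul c
    · rw [dlift_smul]
      exact hf.2.2.2.const_smul c

/-- The inclusion of `H¹` in `L²`. -/
noncomputable def toL2 [Countable E] : G.H1 →ₗ[ℝ] Lp ℝ 2 G.meas where
  toFun f := (G.memH1_iff.1 f.2).2.2.1.toLp
  map_add' _ _ := rfl
  map_smul' _ _ := rfl

/-- The derivative as a map from `H¹` to `L²`. -/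
noncomputable def derivL2 [Countable E] : G.H1 →ₗ[ℝ] Lp ℝ 2 G.meas where
  toFun f := (G.memH1_iff.1 f.2).2.2.2.toLp
  map_add' f g := by
    rw [← MemLp.toLp_add, MemLp.toLp_eq_toLp_iff]
    exact G.dlift_add_ae (G.memH1_iff.1 f.2).2.1 (G.memH1_iff.1 g.2).2.1
  map_smul' c f := by
    rw [RingHom.id_apply, ← MemLp.toLp_const_smul, MemLp.toLp_eq_toLp_iff]
    exact .of_eq (G.dlift_smul c f)

theorem inner_toLp {α : Type*} {m : MeasurableSpace α} {μ : Measure α} {f g : α → ℝ}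
    (hf : MemLp f 2 μ) (hg : MemLp g 2 μ) :
    inner ℝ hf.toLp hg.toLp = ∫ a, f a * g a ∂μ := by
  rw [L2.inner_def]
  refine integral_congr_ae ?_
  filter_upwards [hf.coeFn_toLp, hg.coeFn_toLp] with a h1 h2
  simp [h1, h2, mul_comm]

theorem inner_toL2 [Countable E] (f g : G.H1) :
    inner ℝ (G.toL2 f) (G.toL2 g) = G.l2Inner f g := by
  have hf := (G.memH1_iff.1 f.2).2.2.1
  have hg := (G.memH1_iff.1 g.2).2.2.1
  exact (inner_toLp hf hg).trans (G.integral_meas (hf.integrable_mul hg))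

theorem inner_derivL2 [Countable E] (f g : G.H1) :
    inner ℝ (G.derivL2 f) (G.derivL2 g) = G.neumannForm f g := by
  have hf := (G.memH1_iff.1 f.2).2.2.2
  have hg := (G.memH1_iff.1 g.2).2.2.2
  exact (inner_toLp hf hg).trans (G.integral_meas (hf.integrable_mul hg))

/-! ### Consequences of connectedness: attained values, Hölder and sup bounds -/

/-- In a chain of finite length each pair lies on a single edge, where the intermediate value
theorem applies; between consecutive pairs the point of the graph does not change. -/
theorem uIcc_subset_iUnion_image (hconn : G.Connected) {f : G.Pt → ℝ} (hf : Continuous f)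
    (p q : G.Pt) : uIcc (f p) (f q) ⊆ ⋃ e, G.onEdge f e '' Icc 0 (G.len e) := by
  have h : G.gdist p q < ⊤ := hconn p q
  simp only [gdist, iInf_lt_iff] at h
  obtain ⟨n, ξ, θ, ⟨h0, h1, h2⟩, hs⟩ := h
  have hstep : ∀ k ≤ n, uIcc (f (G.proj (ξ k))) (f (G.proj (θ k))) ⊆
      ⋃ e, G.onEdge f e '' Icc 0 (G.len e) := by
    intro k hk
    have hfin : G.segDist (ξ k) (θ k) < ⊤ :=
      ENNReal.sum_lt_top.1 hs k (Finset.mem_range.2 (by omega))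
    generalize ξ k = a at *
    generalize θ k = b at *
    obtain ⟨⟨e, x⟩, hx⟩ := a
    obtain ⟨⟨e', y⟩, hy⟩ := b
    have hee : e = e' := by
      by_contra hne
      simp [segDist, hne] at hfin
    subst hee
    rw [← G.pt_eq_proj hx, ← G.pt_eq_proj hy]
    have hc : ContinuousOn (G.onEdge f e) (uIcc x y) :=
      (hf.comp (G.continuous_pt e)).continuousOn
    exact (intermediate_value_uIcc hc).trans ((image_mono (uIcc_subset_Icc hx hy)).trans
      (subset_iUnion (fun e => G.onEdge f e '' Icc 0 (G.len e)) e))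
  have hind : ∀ k ≤ n, uIcc (f p) (f (G.proj (θ k))) ⊆
      ⋃ e, G.onEdge f e '' Icc 0 (G.len e) := by
    intro k
    induction k with
    | zero => intro hk; simpa [h0] using hstep 0 hk
    | succ k ih =>
      intro hk
      refine uIcc_subset_uIcc_union_uIcc.trans (union_subset (ih (by omega)) ?_)
      rw [h2 k (by omega)]
      exact hstep (k + 1) hk
  simpa [h1] using hind n le_rfl

theorem _root_.AbsolutelyContinuousOnInterval.enorm_sub_le_lintegral {h : ℝ → ℝ} {a b x y : ℝ}
    (hh : AbsolutelyContinuousOnInterval h a b) (hx : x ∈ uIcc a b) (hy : y ∈ uIcc a b) :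
    ‖h y - h x‖ₑ ≤ ∫⁻ t in uIoc x y, ‖deriv h t‖ₑ := by
  rw [← (hh.mono (uIcc_subset_uIcc hx hy)).integral_deriv_eq_sub]
  have := intervalIntegral.norm_integral_eq_norm_integral_uIoc (deriv h) (a := x) (b := y)
    (μ := volume)
  rw [← enorm_eq_iff_norm_eq] at this
  rw [this]
  exact enorm_integral_le_lintegral_enorm _

theorem _root_.AbsolutelyContinuousOnInterval.volume_image_le {h : ℝ → ℝ} {a b : ℝ} (hab : a ≤ b)
    (hh : AbsolutelyContinuousOnInterval h a b) :
    volume (h '' Icc a b) ≤ ∫⁻ t in Icc a b, ‖deriv h t‖ₑ := by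
  have hc : ContinuousOn h (Icc a b) := uIcc_of_le hab ▸ hh.continuousOn
  obtain ⟨x, hx, hxm⟩ := isCompact_Icc.exists_isMinOn (nonempty_Icc.2 hab) hc
  obtain ⟨y, hy, hym⟩ := isCompact_Icc.exists_isMaxOn (nonempty_Icc.2 hab) hc
  have hsub : h '' Icc a b ⊆ Icc (h x) (h y) := by
    rintro _ ⟨t, ht, rfl⟩
    exact ⟨hxm ht, hym ht⟩
  refine (measure_mono hsub).trans ?_
  rw [Real.volume_Icc]
  refine (ENNReal.ofReal_le_ofReal (le_abs_self _)).trans ?_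
  rw [← Real.norm_eq_abs, ofReal_norm]
  refine (hh.enorm_sub_le_lintegral (uIcc_of_le hab ▸ hx) (uIcc_of_le hab ▸ hy)).trans ?_
  exact lintegral_mono_set (uIoc_subset_uIcc.trans (uIcc_subset_Icc hx hy))

theorem enorm_sub_le_lintegral_dlift [Countable E] (hconn : G.Connected) {f : G.Pt → ℝ}
    (hf : Continuous f) (hac : ∀ e, AbsolutelyContinuousOnInterval (G.onEdge f e) 0 (G.len e))
    (p q : G.Pt) : ‖f q - f p‖ₑ ≤ ∫⁻ a, ‖G.dlift f a‖ₑ ∂G.meas := by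
  have h1 : ‖f q - f p‖ₑ = volume (uIcc (f p) (f q)) := by
    rw [Real.volume_interval, ← ofReal_norm, Real.norm_eq_abs]
  rw [h1, lintegral_meas]
  refine (measure_mono (G.uIcc_subset_iUnion_image hconn hf p q)).trans
    ((measure_iUnion_le _).trans (ENNReal.tsum_le_tsum fun e => ?_))
  exact (hac e).volume_image_le (G.len_pos e).le

/-- A coarea-type inequality: each level between `ρ p` and `ρ q` is attained on some edge, and a
1-Lipschitz map does not increase one-dimensional Hausdorff measure. -/
theorem volume_restrict_le_map_lift [Countable E] (hconn : G.Connected) {ρ : G.Pt → ℝ}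
    (hρ : Continuous ρ) (hlip : ∀ e, LipschitzWith 1 (G.onEdge ρ e)) (p q : G.Pt) :
    volume.restrict (uIcc (ρ p) (ρ q)) ≤ G.meas.map (G.lift ρ) := by
  refine Measure.le_iff.2 fun s hs => ?_
  have hm := (G.aestronglyMeasurable_lift hρ).aemeasurable
  have h2 : G.meas (G.lift ρ ⁻¹' s) =
      ∑' e, volume (G.onEdge ρ e ⁻¹' s ∩ Icc 0 (G.len e)) := by
    rw [← Measure.map_apply_of_aemeasurable hm hs, ← lintegral_indicator_one hs,
      lintegral_map' (by fun_prop (disch := assumption)) hm, lintegral_meas]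
    refine tsum_congr fun e => ?_
    have hmeas : MeasurableSet (G.onEdge ρ e ⁻¹' s) := (hlip e).continuous.measurable hs
    rw [← Measure.restrict_apply hmeas, ← lintegral_indicator_one hmeas]
    rfl
  rw [Measure.map_apply_of_aemeasurable hm hs, h2, Measure.restrict_apply hs]
  have hsub : s ∩ uIcc (ρ p) (ρ q) ⊆
      ⋃ e, G.onEdge ρ e '' (G.onEdge ρ e ⁻¹' s ∩ Icc 0 (G.len e)) := by
    rintro t ⟨hts, ht⟩
    obtain ⟨e, x, hx, rfl⟩ := mem_iUnion.1 (G.uIcc_subset_iUnion_image hconn hρ p q ht)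
    exact mem_iUnion.2 ⟨e, x, ⟨hts, hx⟩, rfl⟩
  refine (measure_mono hsub).trans
    ((measure_iUnion_le _).trans (ENNReal.tsum_le_tsum fun e => ?_))
  have := (hlip e).lipschitzOnWith (s := G.onEdge ρ e ⁻¹' s ∩ Icc 0 (G.len e))
    |>.hausdorffMeasure_image_le (d := 1) zero_le_one
  simpa [hausdorffMeasure_real] using this

/-- Cauchy–Schwarz on part of one edge; for derivatives it yields Hölder continuity with exponent `1
/ 2`. -/
theorem lintegral_edge_le [Countable E] {g : (_ : E) × ℝ → ℝ}
    (hg : AEStronglyMeasurable g G.meas) (e : E) {s : Set ℝ} (hs : s ⊆ Icc 0 (G.len e)) :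
    ∫⁻ x in s, ‖g ⟨e, x⟩‖ₑ ≤ eLpNorm g 2 G.meas * volume s ^ (1 / 2 : ℝ) := by
  have hm : AEStronglyMeasurable (fun x => g ⟨e, x⟩) (volume.restrict s) :=
    (G.aestronglyMeasurable_meas.1 hg e).mono_measure (Measure.restrict_mono hs le_rfl)
  rw [← eLpNorm_one_eq_lintegral_enorm]
  refine (eLpNorm_le_eLpNorm_mul_rpow_measure_univ one_le_two hm).trans ?_
  rw [Measure.restrict_apply_univ]
  refine mul_le_mul' ?_ (le_of_eq ?_)
  · refine (eLpNorm_mono_measure _ (Measure.restrict_mono hs le_rfl)).trans ?_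
    refine le_trans (le_of_eq ?_) (eLpNorm_mono_measure g (G.map_mk_le_meas e))
    exact ((Sigma.measurableEmbedding_mk e).eLpNorm_map_measure).symm
  · norm_num

theorem norm_toL2 [Countable E] (f : G.H1) :
    ‖G.toL2 f‖ = (eLpNorm (G.lift f) 2 G.meas).toReal :=
  Lp.norm_toLp _ (G.memH1_iff.1 f.2).2.2.1

theorem norm_derivL2 [Countable E] (f : G.H1) :
    ‖G.derivL2 f‖ = (eLpNorm (G.dlift f) 2 G.meas).toReal :=
  Lp.norm_toLp _ (G.memH1_iff.1 f.2).2.2.2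

theorem abs_onEdge_sub_le [Countable E] (f : G.H1) (e : E) {x y : ℝ}
    (hx : x ∈ Icc 0 (G.len e)) (hy : y ∈ Icc 0 (G.len e)) :
    |G.onEdge f e y - G.onEdge f e x| ≤ ‖G.derivL2 f‖ * √|y - x| := by
  have hf := G.memH1_iff.1 f.2
  have h0 := (G.len_pos e).le
  have h1 := (hf.2.1 e).enorm_sub_le_lintegral (uIcc_of_le h0 ▸ hx) (uIcc_of_le h0 ▸ hy)
  have h2 := G.lintegral_edge_le hf.2.2.2.1 e (uIoc_subset_uIcc.trans (uIcc_subset_Icc hx hy))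
  have h3 := ENNReal.toReal_mono (ENNReal.mul_ne_top hf.2.2.2.2.ne
    (ENNReal.rpow_ne_top_of_nonneg (by norm_num) (by simp))) (h1.trans h2)
  rw [toReal_enorm, ENNReal.toReal_mul, ← norm_derivL2, ← ENNReal.toReal_rpow] at h3
  simpa [Real.sqrt_eq_rpow] using h3

theorem abs_sub_le [Countable E] (hconn : G.Connected) {L : ℝ} (hL : 0 < L)
    (hGL : G.totalLength = ENNReal.ofReal L) (f : G.H1) (p q : G.Pt) :
    |(f : G.Pt → ℝ) q - (f : G.Pt → ℝ) p| ≤ ‖G.derivL2 f‖ * √L := by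
  have hf := G.memH1_iff.1 f.2
  have h1 := G.enorm_sub_le_lintegral_dlift hconn hf.1 hf.2.1 p q
  rw [← eLpNorm_one_eq_lintegral_enorm] at h1
  have h2 := eLpNorm_le_eLpNorm_mul_rpow_measure_univ one_le_two hf.2.2.2.1
  rw [meas_univ, hGL] at h2
  have h3 := ENNReal.toReal_mono (ENNReal.mul_ne_top hf.2.2.2.2.ne
    (ENNReal.rpow_ne_top_of_nonneg (by norm_num) (by simp))) (h1.trans h2)
  rw [toReal_enorm, ENNReal.toReal_mul, ← norm_derivL2, ← ENNReal.toReal_rpow,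
    ENNReal.toReal_ofReal hL.le] at h3
  rw [Real.sqrt_eq_rpow, ← Real.norm_eq_abs]
  convert h3 using 3
  norm_num

/-- The oscillation is controlled by `abs_sub_le`. A larger value at `p` would keep `|f|` above
`‖G.toL2 f‖ / √L` everywhere, contradicting the `L²` norm. -/
theorem abs_le [Countable E] (hconn : G.Connected) {L : ℝ} (hL : 0 < L)
    (hGL : G.totalLength = ENNReal.ofReal L) (f : G.H1) (p : G.Pt) :
    |(f : G.Pt → ℝ) p| ≤ ‖G.derivL2 f‖ * √L + ‖G.toL2 f‖ / √L := by
  by_contra! hcon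
  set c := |(f : G.Pt → ℝ) p| - ‖G.derivL2 f‖ * √L with hc
  have hs : 0 < √L := Real.sqrt_pos.2 hL
  have hc0 : 0 < c := by
    have : 0 ≤ ‖G.toL2 f‖ / √L := by positivity
    linarith
  have hf := G.memH1_iff.1 f.2
  have h1 : ∀ a, ‖c‖ ≤ ‖G.lift f a‖ := by
    intro a
    have := G.abs_sub_le hconn hL hGL f p (G.pt a.1 a.2)
    have h2 := abs_sub_abs_le_abs_sub ((f : G.Pt → ℝ) p) ((f : G.Pt → ℝ) (G.pt a.1 a.2))
    rw [abs_sub_comm] at h2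
    rw [Real.norm_of_nonneg hc0.le, Real.norm_eq_abs]
    change c ≤ |(f : G.Pt → ℝ) (G.pt a.1 a.2)|
    linarith
  have h2 := eLpNorm_mono (p := 2) (μ := G.meas) h1
  rw [eLpNorm_const' _ two_ne_zero ENNReal.ofNat_ne_top, meas_univ, hGL] at h2
  have h3 := ENNReal.toReal_mono hf.2.2.1.2.ne h2
  rw [← norm_toL2, ENNReal.toReal_mul, toReal_enorm, ← ENNReal.toReal_rpow,
    ENNReal.toReal_ofReal hL.le, Real.norm_of_nonneg hc0.le, ENNReal.toReal_ofNat,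
    ← Real.sqrt_eq_rpow, ← le_div_iff₀ hs] at h3
  linarith

end MetricGraph

/-! ### Compactness of the embedding into `L²` and closedness of the form -/

theorem MeasureTheory.memLp_tendsto_of_bounded {α : Type*} {m : MeasurableSpace α} {μ : Measure α}
    [IsFiniteMeasure μ] {F : ℕ → α → ℝ} {g : α → ℝ} (hF : ∀ n, AEStronglyMeasurable (F n) μ) {C : ℝ}
    (hC : ∀ n a, ‖F n a‖ ≤ C) (h : ∀ a, Tendsto (fun n => F n a) atTop (𝓝 (g a))) :
    MemLp g 2 μ ∧ Tendsto (fun n => eLpNorm (F n - g) 2 μ) atTop (𝓝 0) := by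
  have hg : AEStronglyMeasurable g μ :=
    aestronglyMeasurable_of_tendsto_ae atTop hF (.of_forall h)
  have hgC : ∀ a, ‖g a‖ ≤ C := fun a =>
    le_of_tendsto' (h a).norm fun n => hC n a
  refine ⟨MemLp.of_bound hg C (.of_forall hgC), ?_⟩
  have key : Tendsto (fun n => ∫⁻ a, ‖F n a - g a‖ₑ ^ 2 ∂μ) atTop (𝓝 (∫⁻ _, 0 ∂μ)) := by
    refine tendsto_lintegral_of_dominated_convergence' (fun _ => ENNReal.ofReal (2 * C) ^ 2)
      (fun n => ((hF n).sub hg).enorm.pow_const 2) (fun n => .of_forall fun a => ?_) ?_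
      (.of_forall fun a => ?_)
    · refine pow_le_pow_left' ?_ 2
      rw [← ofReal_norm]
      refine ENNReal.ofReal_le_ofReal ((norm_sub_le _ _).trans ?_)
      linarith [hC n a, hgC a]
    · simp [ENNReal.mul_eq_top]
    · have := ((h a).sub_const (g a)).enorm
      rw [sub_self, enorm_zero] at this
      simpa using! (ENNReal.continuous_pow 2).tendsto _ |>.comp this
  rw [lintegral_zero] at key
  have := (ENNReal.continuous_rpow_const (y := 1 / 2)).tendsto _ |>.comp key
  rw [ENNReal.zero_rpow_of_pos (by norm_num)] at this
  refine this.congr fun n => ?_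
  simp [eLpNorm_eq_lintegral_rpow_enorm_toReal two_ne_zero ENNReal.ofNat_ne_top]

theorem AbsolutelyContinuousOnInterval.congr {f g : ℝ → ℝ} {a b : ℝ}
    (hf : AbsolutelyContinuousOnInterval f a b) (h : EqOn f g (uIcc a b)) :
    AbsolutelyContinuousOnInterval g a b := by
  rw [absolutelyContinuousOnInterval_iff] at hf ⊢
  intro ε hε
  obtain ⟨δ, hδ, H⟩ := hf ε hε
  refine ⟨δ, hδ, fun I hI hs => ?_⟩
  rw [← Finset.sum_congr rfl fun i hi => ?_]
  · exact H I hI hs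
  · rw [h (hI.1 i hi).1, h (hI.1 i hi).2]

namespace MetricGraph

variable {E : Type*} (G : MetricGraph E)

theorem pt_projIcc (e : E) (x : ℝ) :
    G.pt e (projIcc 0 (G.len e) (G.len_pos e).le x) = G.pt e x := by
  simp [pt]

theorem abs_onEdge_sub_le' [Countable E] (f : G.H1) (e : E) (x y : ℝ) :
    |G.onEdge f e y - G.onEdge f e x| ≤ ‖G.derivL2 f‖ * √|y - x| := by
  have h0 := (G.len_pos e).le
  have := G.abs_onEdge_sub_le f e (projIcc 0 (G.len e) h0 x).2 (projIcc 0 (G.len e) h0 y).2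
  simp only [onEdge, pt_projIcc] at this
  exact this.trans (mul_le_mul_of_nonneg_left (Real.sqrt_le_sqrt (abs_projIcc_sub_projIcc h0))
    (norm_nonneg _))

/-- Arzelà–Ascoli edge by edge: uniform bounds and a common Hölder constant give a pointwise
convergent subsequence, and dominated convergence on the finite length measure does the rest. -/
theorem exists_subseq_cauchySeq_toL2 [Countable E] (hconn : G.Connected) {L : ℝ} (hL : 0 < L)
    (hGL : G.totalLength = ENNReal.ofReal L) (f : ℕ → G.H1) {C : ℝ}
    (hA : ∀ n, ‖G.derivL2 (f n)‖ ≤ C) (hJ : ∀ n, ‖G.toL2 (f n)‖ ≤ C) :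
    ∃ φ : ℕ → ℕ, StrictMono φ ∧ CauchySeq fun n => G.toL2 (f (φ n)) := by
  have : IsFiniteMeasure G.meas := ⟨by rw [meas_univ, hGL]; exact ENNReal.ofReal_lt_top⟩
  have hC0 : 0 ≤ C := (norm_nonneg _).trans (hA 0)
  set B := C * √L + C / √L with hB
  have hbd : ∀ n p, |(f n : G.Pt → ℝ) p| ≤ B := fun n p =>
    (G.abs_le hconn hL hGL (f n) p).trans (by rw [hB]; gcongr; exacts [hA n, hJ n])
  -- A countable product of intervals is sequentially compact, which replaces a diagonal argument.
  -- Rational coordinates outside an edge are harmless, since `pt` clamps them.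
  have hK : IsCompact (Set.pi univ fun _ : E × ℚ => Icc (-B) B) :=
    isCompact_univ_pi fun _ => isCompact_Icc
  obtain ⟨l, -, φ, hφ, hl⟩ := hK.tendsto_subseq
    (x := fun n (i : E × ℚ) => G.onEdge (f n) i.1 (i.2 : ℝ))
    (fun n i _ => mem_Icc.2 (_root_.abs_le.1 (hbd n _)))
  rw [tendsto_pi_nhds] at hl
  have hpt : ∀ a : (_ : E) × ℝ, CauchySeq fun n => G.lift (f (φ n)) a := by
    rintro ⟨e, x⟩
    refine Metric.cauchySeq_iff.2 fun ε hε => ?_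
    have hopen : IsOpen {y : ℝ | C * √|y - x| < ε / 3} := isOpen_lt (by fun_prop) continuous_const
    obtain ⟨q, hq⟩ := Rat.denseRange_cast.exists_mem_open hopen ⟨x, by simp; positivity⟩
    obtain ⟨N, hN⟩ := Metric.cauchySeq_iff.1 (hl (e, q)).cauchySeq (ε / 3) (by positivity)
    refine ⟨N, fun n hn k hk => ?_⟩
    have h1 := hN n hn k hk
    have hhol : ∀ j, |G.onEdge (f j) e q - G.onEdge (f j) e x| < ε / 3 := fun j =>
      ((G.abs_onEdge_sub_le' (f j) e x q).trans (by gcongr; exact hA j)).trans_lt hq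
    have h2 := hhol (φ n)
    have h3 := hhol (φ k)
    rw [Real.dist_eq, abs_lt] at *
    simp only [lift, Function.comp] at *
    constructor <;> linarith
  choose g hg using fun a => cauchySeq_tendsto_of_complete (hpt a)
  obtain ⟨hmem, hlim⟩ := memLp_tendsto_of_bounded (μ := G.meas)
    (F := fun n => G.lift (f (φ n))) (g := g)
    (fun n => G.aestronglyMeasurable_lift (G.memH1_iff.1 (f (φ n)).2).1) (C := B)
    (fun n a => hbd _ _) hg
  refine ⟨φ, hφ, ((Lp.tendsto_Lp_iff_tendsto_eLpNorm'' _
    (fun n => (G.memH1_iff.1 (f (φ n)).2).2.2.1) g hmem).2 hlim).cauchySeq⟩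

/-- By `abs_le` the sequence is uniformly Cauchy, so its limit is continuous on the whole graph; on
each edge the limit is a primitive of the `L²` limit of the derivatives. -/
theorem exists_tendsto_of_cauchySeq [Countable E] (hconn : G.Connected) {L : ℝ} (hL : 0 < L)
    (hGL : G.totalLength = ENNReal.ofReal L) (f : ℕ → G.H1)
    (hA : CauchySeq fun n => G.derivL2 (f n)) (hJ : CauchySeq fun n => G.toL2 (f n)) :
    ∃ g : G.H1, Tendsto (fun n => G.derivL2 (f n)) atTop (𝓝 (G.derivL2 g)) ∧
      Tendsto (fun n => G.toL2 (f n)) atTop (𝓝 (G.toL2 g)) := by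
  have : IsFiniteMeasure G.meas := ⟨by rw [meas_univ, hGL]; exact ENNReal.ofReal_lt_top⟩
  have hs : 0 < √L := Real.sqrt_pos.2 hL
  obtain ⟨w, hw⟩ := cauchySeq_tendsto_of_complete hA
  obtain ⟨C₁, hC₁⟩ := hA.norm_bddAbove
  obtain ⟨C₂, hC₂⟩ := hJ.norm_bddAbove
  set B := C₁ * √L + C₂ / √L with hB
  have hbd : ∀ n p, |(f n : G.Pt → ℝ) p| ≤ B := fun n p =>
    (G.abs_le hconn hL hGL (f n) p).trans
      (by rw [hB]; gcongr; exacts [hC₁ ⟨n, rfl⟩, hC₂ ⟨n, rfl⟩])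
  have hunif : UniformCauchySeqOn (fun n => (f n : G.Pt → ℝ)) atTop univ := by
    refine Metric.uniformCauchySeqOn_iff.2 fun ε hε => ?_
    obtain ⟨N₁, h₁⟩ := Metric.cauchySeq_iff.1 hA (ε / 2 / √L) (by positivity)
    obtain ⟨N₂, h₂⟩ := Metric.cauchySeq_iff.1 hJ (ε / 2 * √L) (by positivity)
    refine ⟨max N₁ N₂, fun n hn k hk p _ => ?_⟩
    have h1 := h₁ n (le_of_max_le_left hn) k (le_of_max_le_left hk)
    have h2 := h₂ n (le_of_max_le_right hn) k (le_of_max_le_right hk)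
    rw [dist_eq_norm, ← map_sub] at h1 h2
    rw [lt_div_iff₀ hs] at h1
    rw [← div_lt_iff₀ hs] at h2
    have := G.abs_le hconn hL hGL (f n - f k) p
    rw [Real.dist_eq]
    exact this.trans_lt (by linarith)
  choose g hg using fun p => cauchySeq_tendsto_of_complete (hunif.cauchySeq (mem_univ p))
  have hgu : TendstoUniformly (fun n => (f n : G.Pt → ℝ)) g atTop :=
    tendstoUniformlyOn_univ.1 (hunif.tendstoUniformlyOn_of_tendsto fun p _ => hg p)
  have hgc : Continuous g :=
    hgu.continuous (Frequently.of_forall fun n => (G.memH1_iff.1 (f n).2).1)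
  obtain ⟨hmem, hlim⟩ := memLp_tendsto_of_bounded (μ := G.meas)
    (F := fun n => G.lift (f n)) (g := G.lift g)
    (fun n => G.aestronglyMeasurable_lift (G.memH1_iff.1 (f n).2).1) (C := B)
    (fun n a => hbd _ _) fun a => hg _
  have hwm := Lp.memLp w
  have hint : ∀ e, IntervalIntegrable (fun x => w ⟨e, x⟩) volume 0 (G.len e) := by
    intro e
    rw [intervalIntegrable_iff_integrableOn_Icc_of_le (G.len_pos e).le]
    refine ⟨G.aestronglyMeasurable_meas.1 hwm.1 e, ?_⟩
    refine (G.lintegral_edge_le hwm.1 e Subset.rfl).trans_lt (ENNReal.mul_lt_top hwm.2 ?_)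
    exact ENNReal.rpow_lt_top_of_nonneg (by norm_num) (by simp)
  have hwlim : Tendsto (fun n => eLpNorm (G.dlift (f n) - ⇑w) 2 G.meas) atTop (𝓝 0) := by
    have := (Lp.tendsto_Lp_iff_tendsto_eLpNorm' _ _).1 hw
    refine this.congr fun n => eLpNorm_congr_ae ?_
    filter_upwards [(G.memH1_iff.1 (f n).2).2.2.2.coeFn_toLp] with a ha
    simp only [Pi.sub_apply]
    rw [← ha]
    rfl
  -- The fundamental theorem of calculus for `f n` passes to the limit, as `L²` convergence of
  -- derivatives implies `L¹` convergence on each edge.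
  have hprim : ∀ e, EqOn (fun x => g (G.pt e 0) + ∫ t in (0 : ℝ)..x, w ⟨e, t⟩) (G.onEdge g e)
      (uIcc 0 (G.len e)) := by
    intro e x hx
    have h0 := (G.len_pos e).le
    have hx' : x ∈ Icc 0 (G.len e) := uIcc_of_le h0 ▸ hx
    have hsub : uIcc 0 x ⊆ uIcc 0 (G.len e) := uIcc_subset_uIcc left_mem_uIcc hx
    have h1 : Tendsto (fun n => ∫ t in (0 : ℝ)..x, G.dlift (f n) ⟨e, t⟩) atTop
        (𝓝 (∫ t in (0 : ℝ)..x, w ⟨e, t⟩)) := by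
      rw [tendsto_iff_edist_tendsto_0]
      have hz : Tendsto (fun n => eLpNorm (G.dlift (f n) - ⇑w) 2 G.meas *
          volume (uIoc 0 x) ^ (1 / 2 : ℝ)) atTop (𝓝 0) := by
        have := ENNReal.Tendsto.mul_const hwlim (b := volume (uIoc 0 x) ^ (1 / 2 : ℝ))
          (Or.inr (ENNReal.rpow_ne_top_of_nonneg (by norm_num) (by simp)))
        rwa [zero_mul] at this
      refine tendsto_of_tendsto_of_tendsto_of_le_of_le tendsto_const_nhds hz
        (fun _ => zero_le) fun n => ?_
      have hfn := (G.memH1_iff.1 (f n).2).2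
      have hI := ((hfn.1 e).mono hsub).intervalIntegrable_deriv
      change edist (∫ t in (0 : ℝ)..x, deriv (G.onEdge (f n) e) t) _ ≤ _
      rw [edist_eq_enorm_sub, ← intervalIntegral.integral_sub hI ((hint e).mono_set hsub)]
      have hni := intervalIntegral.norm_integral_eq_norm_integral_uIoc
        (fun t => deriv (G.onEdge (f n) e) t - w ⟨e, t⟩) (a := 0) (b := x) (μ := volume)
      rw [← enorm_eq_iff_norm_eq] at hni
      rw [hni]
      refine (enorm_integral_le_lintegral_enorm _).trans ?_
      exact G.lintegral_edge_le (hfn.2.2.1.sub hwm.1) e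
        (uIoc_subset_uIcc.trans (uIcc_subset_Icc (left_mem_Icc.2 h0) hx'))
    refine tendsto_nhds_unique (h1.const_add _) (((hg (G.pt e x)).sub (hg (G.pt e 0))).const_add
      (g (G.pt e 0)) |>.congr fun n => ?_) |>.trans (by simp [onEdge])
    have := (((G.memH1_iff.1 (f n).2).2.1 e).mono hsub).integral_deriv_eq_sub
    simp only [dlift, this]
    rfl
  have hac : ∀ e, AbsolutelyContinuousOnInterval (G.onEdge g e) 0 (G.len e) := by
    intro e
    refine AbsolutelyContinuousOnInterval.congr ?_ (hprim e)
    exact (LipschitzWith.const (g (G.pt e 0))).lipschitzOnWith.absolutelyContinuousOnInterval.add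
      ((hint e).absolutelyContinuousOnInterval_intervalIntegral left_mem_uIcc)
  have hdw : G.dlift g =ᵐ[G.meas] w := by
    refine G.ae_meas_iff.2 fun e => ?_
    -- Endpoints are discarded because `deriv` there also sees the clamped values outside the edge.
    rw [← restrict_Ioo_eq_restrict_Icc]
    refine (ae_restrict_iff' measurableSet_Ioo).2 ?_
    filter_upwards [(hint e).ae_hasDerivAt_integral] with x hx hxI
    have hxu : x ∈ uIcc 0 (G.len e) := uIcc_of_le (G.len_pos e).le ▸ Ioo_subset_Icc_self hxI
    have h1 := (hx hxu 0 left_mem_uIcc).const_add (g (G.pt e 0))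
    refine (h1.congr_of_eventuallyEq ?_).deriv
    filter_upwards [isOpen_Ioo.mem_nhds hxI] with y hy
    exact (hprim e (uIcc_of_le (G.len_pos e).le ▸ Ioo_subset_Icc_self hy)).symm
  have hd2 : MemLp (G.dlift g) 2 G.meas := (memLp_congr_ae hdw).2 hwm
  refine ⟨⟨g, G.memH1_iff.2 ⟨hgc, hac, hmem, hd2⟩⟩, ?_, ?_⟩
  · convert hw
    exact Lp.ext (hd2.coeFn_toLp.trans hdw)
  · exact (Lp.tendsto_Lp_iff_tendsto_eLpNorm'' _
      (fun n => (G.memH1_iff.1 (f n).2).2.2.1) _ hmem).2 hlim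

end MetricGraph

/-! ### Abstract variational principle for a pair of linear maps -/

section Variational

variable {V H₁ H₂ : Type*} [AddCommGroup V] [Module ℝ V]
  [NormedAddCommGroup H₁] [InnerProductSpace ℝ H₁]
  [NormedAddCommGroup H₂] [InnerProductSpace ℝ H₂]

/-- The direct method, with `A` as derivative and `J` as inclusion in `L²`, so that `V` needs no
topology. Compactness makes a minimizing sequence Cauchy under `J`, the parallelogram law then makes
it Cauchy under `A`, and `hcompl` supplies the limit. -/
theorem exists_rayleigh_minimizer (A : V →ₗ[ℝ] H₁) (J : V →ₗ[ℝ] H₂) (u : V)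
    (hcpt : ∀ (f : ℕ → V) (C : ℝ), (∀ n, ‖A (f n)‖ ≤ C) → (∀ n, ‖J (f n)‖ ≤ C) →
      ∃ φ : ℕ → ℕ, StrictMono φ ∧ CauchySeq fun n => J (f (φ n)))
    (hcompl : ∀ f : ℕ → V, CauchySeq (fun n => A (f n)) → CauchySeq (fun n => J (f n)) →
      ∃ g, Tendsto (fun n => A (f n)) atTop (𝓝 (A g)) ∧
        Tendsto (fun n => J (f n)) atTop (𝓝 (J g)))
    (hne : ∃ w, inner ℝ (J u) (J w) = 0 ∧ J w ≠ 0) :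
    ∃ g, inner ℝ (J u) (J g) = 0 ∧ ‖J g‖ = 1 ∧
      ∀ w, inner ℝ (J u) (J w) = 0 → ‖A g‖ ^ 2 * ‖J w‖ ^ 2 ≤ ‖A w‖ ^ 2 := by
  set S : Set ℝ := {t | ∃ f, inner ℝ (J u) (J f) = 0 ∧ ‖J f‖ = 1 ∧ ‖A f‖ ^ 2 = t} with hS
  have hbdd : BddBelow S := ⟨0, by rintro _ ⟨f, -, -, rfl⟩; positivity⟩
  have hscale : ∀ w, inner ℝ (J u) (J w) = 0 → J w ≠ 0 → ‖A w‖ ^ 2 / ‖J w‖ ^ 2 ∈ S := by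
    intro w hw hw0
    have h0 := norm_ne_zero_iff.2 hw0
    refine ⟨‖J w‖⁻¹ • w, ?_, ?_, ?_⟩
    · rw [map_smul, inner_smul_right, hw, mul_zero]
    · rw [map_smul, norm_smul, norm_inv, norm_norm, inv_mul_cancel₀ h0]
    · rw [map_smul, norm_smul, norm_inv, norm_norm]
      field_simp
  have hSne : S.Nonempty := by
    obtain ⟨w, hw, hw0⟩ := hne
    exact ⟨_, hscale w hw hw0⟩
  set μ := sInf S with hμ
  have hμ0 : 0 ≤ μ := Real.sInf_nonneg (by rintro _ ⟨f, -, -, rfl⟩; positivity)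
  have hmin : ∀ w, inner ℝ (J u) (J w) = 0 → μ * ‖J w‖ ^ 2 ≤ ‖A w‖ ^ 2 := by
    intro w hw
    by_cases hw0 : J w = 0
    · rw [hw0, norm_zero, zero_pow two_ne_zero, mul_zero]
      positivity
    · have := csInf_le hbdd (hscale w hw hw0)
      rwa [le_div_iff₀ (by have := norm_pos_iff.2 hw0; positivity)] at this
  obtain ⟨a, -, ha, haS⟩ := exists_seq_tendsto_sInf hSne hbdd
  choose f hf0 hf1 hfa using haS
  obtain ⟨C, hC⟩ := ha.bddAbove_range
  have hfC : ∀ n, ‖A (f n)‖ ≤ max C 0 + 1 := by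
    intro n
    have h1 : ‖A (f n)‖ ^ 2 ≤ max C 0 := (hfa n).le.trans ((hC ⟨n, rfl⟩).trans (le_max_left _ _))
    nlinarith [le_max_right C 0]
  obtain ⟨φ, hφ, hJ⟩ := hcpt f (max C 0 + 1) hfC fun n => by
    rw [hf1]
    linarith [le_max_right C 0]
  have haφ : Tendsto (fun n => ‖A (f (φ n))‖ ^ 2) atTop (𝓝 μ) := by
    simp only [hfa]
    exact ha.comp hφ.tendsto_atTop
  have hA : CauchySeq fun n => A (f (φ n)) := by
    refine Metric.cauchySeq_iff.2 fun ε hε => ?_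
    obtain ⟨N₁, h₁⟩ := eventually_atTop.1
      (haφ.eventually (gt_mem_nhds (show μ < μ + ε ^ 2 / 8 by linarith [pow_pos hε 2])))
    obtain ⟨N₂, h₂⟩ := Metric.cauchySeq_iff.1 hJ (ε / (2 * (μ + 1))) (by positivity)
    refine ⟨max N₁ N₂, fun n hn k hk => ?_⟩
    have hn1 := h₁ n (le_of_max_le_left hn)
    have hk1 := h₁ k (le_of_max_le_left hk)
    have hJ1 := h₂ n (le_of_max_le_right hn) k (le_of_max_le_right hk)
    rw [dist_eq_norm] at hJ1 ⊢
    -- The sum of two members is admissible, so its energy is at least `μ (4 - ‖J difference‖²)`.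
    -- Hence the squared `A`-difference is below `ε² / 2 + ε² / 4`.
    have hp := parallelogram_law_with_norm ℝ (A (f (φ n))) (A (f (φ k)))
    have hq := parallelogram_law_with_norm ℝ (J (f (φ n))) (J (f (φ k)))
    have hm := hmin (f (φ n) + f (φ k)) (by rw [map_add, inner_add_right, hf0, hf0, add_zero])
    rw [map_add, map_add] at hm
    rw [hf1, hf1] at hq
    have hδ : μ * ‖J (f (φ n)) - J (f (φ k))‖ ^ 2 ≤ ε ^ 2 / 4 := by
      calc μ * ‖J (f (φ n)) - J (f (φ k))‖ ^ 2 ≤ μ * (ε / (2 * (μ + 1))) ^ 2 := by gcongr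
        _ = ε ^ 2 / 4 * (μ / (μ + 1) ^ 2) := by field_simp; norm_num
        _ ≤ ε ^ 2 / 4 * 1 := by
          gcongr
          rw [div_le_one (by positivity)]
          nlinarith
        _ = ε ^ 2 / 4 := mul_one _
    have hsq : ‖A (f (φ n)) - A (f (φ k))‖ ^ 2 < ε ^ 2 := by
      have hq' : ‖J (f (φ n)) + J (f (φ k))‖ ^ 2 = 4 - ‖J (f (φ n)) - J (f (φ k))‖ ^ 2 := by
        linarith
      rw [hq', mul_sub] at hm
      nlinarith [pow_pos hε 2]
    exact lt_of_pow_lt_pow_left₀ 2 hε.le hsq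
  obtain ⟨g, hgA, hgJ⟩ := hcompl _ hA hJ
  have hμg : ‖A g‖ ^ 2 = μ := tendsto_nhds_unique (hgA.norm.pow 2) haφ
  refine ⟨g, ?_, ?_, ?_⟩
  · refine tendsto_nhds_unique (tendsto_const_nhds.inner hgJ) ?_
    simp only [hf0]
    exact tendsto_const_nhds
  · refine tendsto_nhds_unique hgJ.norm ?_
    simp only [hf1]
    exact tendsto_const_nhds
  · rwa [hμg]

theorem norm_smul_sub_smul_sq {x y : H₁} (h : inner ℝ x y = 0) (c d : ℝ) :
    ‖c • x - d • y‖ ^ 2 = c ^ 2 * ‖x‖ ^ 2 + d ^ 2 * ‖y‖ ^ 2 := by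
  rw [norm_sub_sq_real, inner_smul_left, inner_smul_right, h, norm_smul, norm_smul, mul_pow,
    mul_pow, Real.norm_eq_abs, Real.norm_eq_abs, sq_abs, sq_abs]
  ring

/-- On the span of `w₁`, `w₂` both quadratic forms are diagonal, so the Rayleigh bound passes to
combinations; one linear condition leaves a nonzero one. The case `J u ⟂ J w₁` is separated so that
the coefficient `d` of `w₂` is nonzero. -/
theorem exists_orthogonal_combination (A : V →ₗ[ℝ] H₁) (J : V →ₗ[ℝ] H₂) (u w₁ w₂ : V)
    {Λ : ℝ} (hA : inner ℝ (A w₁) (A w₂) = 0) (hJ : inner ℝ (J w₁) (J w₂) = 0)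
    (h₁ : J w₁ ≠ 0) (h₂ : J w₂ ≠ 0) (hΛ₁ : ‖A w₁‖ ^ 2 ≤ Λ * ‖J w₁‖ ^ 2)
    (hΛ₂ : ‖A w₂‖ ^ 2 ≤ Λ * ‖J w₂‖ ^ 2) :
    ∃ w, inner ℝ (J u) (J w) = 0 ∧ J w ≠ 0 ∧ ‖A w‖ ^ 2 ≤ Λ * ‖J w‖ ^ 2 := by
  by_cases hu : inner ℝ (J u) (J w₁) = 0
  · exact ⟨w₁, hu, h₁, hΛ₁⟩
  set c := inner ℝ (J u) (J w₂)
  set d := inner ℝ (J u) (J w₁)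
  have hexpA : ‖A (c • w₁ - d • w₂)‖ ^ 2 = c ^ 2 * ‖A w₁‖ ^ 2 + d ^ 2 * ‖A w₂‖ ^ 2 := by
    rw [map_sub, map_smul, map_smul, norm_smul_sub_smul_sq hA]
  have hexpJ : ‖J (c • w₁ - d • w₂)‖ ^ 2 = c ^ 2 * ‖J w₁‖ ^ 2 + d ^ 2 * ‖J w₂‖ ^ 2 := by
    rw [map_sub, map_smul, map_smul, norm_smul_sub_smul_sq hJ]
  refine ⟨c • w₁ - d • w₂, ?_, ?_, ?_⟩
  · rw [map_sub, map_smul, map_smul, inner_sub_right, inner_smul_right, inner_smul_right]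
    ring
  · intro h0
    rw [h0, norm_zero] at hexpJ
    have : 0 < d ^ 2 * ‖J w₂‖ ^ 2 := by
      have := norm_pos_iff.2 h₂
      positivity
    nlinarith [mul_nonneg (sq_nonneg c) (sq_nonneg ‖J w₁‖)]
  · rw [hexpA, hexpJ]
    nlinarith [mul_le_mul_of_nonneg_left hΛ₁ (sq_nonneg c),
      mul_le_mul_of_nonneg_left hΛ₂ (sq_nonneg d)]

theorem eq_zero_of_forall_quadratic_nonneg {b c : ℝ} (h : ∀ t : ℝ, 0 ≤ 2 * t * b + t ^ 2 * c) :
    b = 0 := by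
  have hd := discrim_le_zero (a := c) (b := 2 * b) (c := 0) fun t => by linarith [h t]
  rw [discrim] at hd
  nlinarith

/-- The first variation along `g + t • w` gives the equation for `w` in the complement of `u`. A
general `v` differs from such a `w` by a multiple of `u`, which contributes to neither side. -/
theorem weak_equation_of_minimizer (A : V →ₗ[ℝ] H₁) (J : V →ₗ[ℝ] H₂) (u g : V)
    (hAu : A u = 0) (hJu : J u ≠ 0) (hg0 : inner ℝ (J u) (J g) = 0) (hg1 : ‖J g‖ = 1)
    (hmin : ∀ w, inner ℝ (J u) (J w) = 0 → ‖A g‖ ^ 2 * ‖J w‖ ^ 2 ≤ ‖A w‖ ^ 2) (v : V) :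
    inner ℝ (A g) (A v) = ‖A g‖ ^ 2 * inner ℝ (J g) (J v) := by
  have key : ∀ w, inner ℝ (J u) (J w) = 0 →
      inner ℝ (A g) (A w) - ‖A g‖ ^ 2 * inner ℝ (J g) (J w) = 0 := by
    intro w hw
    refine eq_zero_of_forall_quadratic_nonneg
      (c := ‖A w‖ ^ 2 - ‖A g‖ ^ 2 * ‖J w‖ ^ 2) fun t => ?_
    have := hmin (g + t • w) (by
      rw [map_add, map_smul, inner_add_right, inner_smul_right, hg0, hw]; ring)
    rw [map_add, map_add, map_smul, map_smul, norm_add_sq_real, norm_add_sq_real, hg1,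
      inner_smul_right, inner_smul_right, norm_smul, norm_smul, mul_pow, mul_pow,
      Real.norm_eq_abs, sq_abs] at this
    linarith
  have hn : ‖J u‖ ^ 2 ≠ 0 := pow_ne_zero 2 (norm_ne_zero_iff.2 hJu)
  have := key (v - (inner ℝ (J u) (J v) / ‖J u‖ ^ 2) • u) (by
    rw [map_sub, map_smul, inner_sub_right, inner_smul_right, real_inner_self_eq_norm_sq,
      div_mul_cancel₀ _ hn, sub_self])
  rw [map_sub, map_sub, map_smul, map_smul, hAu, smul_zero, sub_zero, inner_sub_right,
    inner_smul_right, real_inner_comm (J u) (J g), hg0, mul_zero, sub_zero] at this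
  linarith

end Variational

/-! ### Existence of the second eigenvalue and its min-max bound -/

namespace MetricGraph

variable {E : Type*} (G : MetricGraph E) [Countable E]

theorem eq_zero_of_toL2_eq_zero {f : G.H1} (h : G.toL2 f = 0) : f = 0 := by
  have hf := G.memH1_iff.1 f.2
  have h1 : G.lift f =ᵐ[G.meas] 0 :=
    hf.2.2.1.coeFn_toLp.symm.trans (Lp.eq_zero_iff_ae_eq_zero.1 h)
  ext p
  obtain ⟨e, x, hx, rfl⟩ := G.exists_pt_eq p
  have h2 : G.onEdge f e =ᵐ[volume.restrict (Icc 0 (G.len e))] fun _ => (0 : ℝ) :=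
    G.ae_meas_iff.1 h1 e
  exact Measure.eqOn_Icc_of_ae_eq volume (G.len_pos e).ne h2
    (hf.1.comp (G.continuous_pt e)).continuousOn continuousOn_const hx

theorem isNeumannEigenfunction_iff (ν : ℝ) (f : G.H1) :
    G.IsNeumannEigenfunction ν f ↔ f ≠ 0 ∧
      ∀ v, inner ℝ (G.derivL2 f) (G.derivL2 v) = ν * inner ℝ (G.toL2 f) (G.toL2 v) := by
  have hl : ∀ v : G.H1, G.l2Inner (ν • (f : G.Pt → ℝ)) v =
      ν * inner ℝ (G.toL2 f) (G.toL2 v) := by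
    intro v
    rw [← real_inner_smul_left, ← map_smul, inner_toL2]
    rfl
  rw [IsNeumannEigenfunction, NeumannLaplacian]
  refine and_congr (by simp) ⟨fun h v => ?_, fun h => ⟨f.2, (ν • f).2.memL2, fun v hv => ?_⟩⟩
  · rw [inner_derivL2, h.2.2 v v.2, hl]
  · exact (G.inner_derivL2 f ⟨v, hv⟩).symm.trans ((h ⟨v, hv⟩).trans (hl ⟨v, hv⟩).symm)

theorem memH1_one {L : ℝ} (hGL : G.totalLength = ENNReal.ofReal L) : G.MemH1 1 := by
  have : IsFiniteMeasure G.meas := ⟨by rw [meas_univ, hGL]; exact ENNReal.ofReal_lt_top⟩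
  refine G.memH1_iff.2 ⟨continuous_one, fun e => ?_, ?_, ?_⟩
  · exact (LipschitzWith.const (1 : ℝ)).lipschitzOnWith.absolutelyContinuousOnInterval
  · exact memLp_const (1 : ℝ)
  · have : G.dlift 1 = fun _ => 0 := by
      funext a
      exact deriv_const _ _
    rw [this]
    exact memLp_const (0 : ℝ)

/-- The eigenvalue is the minimal Rayleigh quotient orthogonal to constants, with the constant `u`
and a minimizer `g` as the two eigenfunctions. `htest` only ensures that this complement is nonzero.
-/
theorem exists_isNeumannEigenvalue_two (hconn : G.Connected) {L : ℝ} (hL : 0 < L)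
    (hGL : G.totalLength = ENNReal.ofReal L)
    (htest : ∃ w₁ w₂ : G.H1, inner ℝ (G.derivL2 w₁) (G.derivL2 w₂) = 0 ∧
      inner ℝ (G.toL2 w₁) (G.toL2 w₂) = 0 ∧ G.toL2 w₁ ≠ 0 ∧ G.toL2 w₂ ≠ 0) :
    ∃ μ : ℝ, G.IsNeumannEigenvalue 2 μ ∧ ∀ (Λ : ℝ) (w₁ w₂ : G.H1),
      inner ℝ (G.derivL2 w₁) (G.derivL2 w₂) = 0 → inner ℝ (G.toL2 w₁) (G.toL2 w₂) = 0 →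
      G.toL2 w₁ ≠ 0 → G.toL2 w₂ ≠ 0 → ‖G.derivL2 w₁‖ ^ 2 ≤ Λ * ‖G.toL2 w₁‖ ^ 2 →
      ‖G.derivL2 w₂‖ ^ 2 ≤ Λ * ‖G.toL2 w₂‖ ^ 2 → μ ≤ Λ := by
  set u : G.H1 := ⟨1, G.memH1_one hGL⟩
  have hu0 : u ≠ 0 := by
    intro h
    obtain ⟨e, -⟩ : ∃ e : E, True := by
      by_contra! hE
      have : IsEmpty E := ⟨fun e => hE e⟩
      rw [totalLength, tsum_empty] at hGL
      exact (ENNReal.ofReal_pos.2 hL).ne hGL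
    have h1 := congrFun (congrArg Subtype.val h) (G.pt e 0)
    exact one_ne_zero h1
  have hJu : G.toL2 u ≠ 0 := fun h => hu0 (G.eq_zero_of_toL2_eq_zero h)
  have hAu : G.derivL2 u = 0 := by
    refine Lp.eq_zero_iff_ae_eq_zero.2
      ((G.memH1_iff.1 u.2).2.2.2.coeFn_toLp.trans (.of_eq ?_))
    funext a
    exact deriv_const _ _
  have hne : ∃ w, inner ℝ (G.toL2 u) (G.toL2 w) = 0 ∧ G.toL2 w ≠ 0 := by
    obtain ⟨w₁, w₂, hA, hJ, h₁, h₂⟩ := htest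
    have hp₁ := norm_pos_iff.2 h₁
    have hp₂ := norm_pos_iff.2 h₂
    obtain ⟨w, hw, hw0, -⟩ := exists_orthogonal_combination G.derivL2 G.toL2 u w₁ w₂
      (Λ := max (‖G.derivL2 w₁‖ ^ 2 / ‖G.toL2 w₁‖ ^ 2) (‖G.derivL2 w₂‖ ^ 2 / ‖G.toL2 w₂‖ ^ 2))
      hA hJ h₁ h₂ ((div_le_iff₀ (by positivity)).1 (le_max_left _ _))
      ((div_le_iff₀ (by positivity)).1 (le_max_right _ _))
    exact ⟨w, hw, hw0⟩
  obtain ⟨g, hg0, hg1, hmin⟩ := exists_rayleigh_minimizer G.derivL2 G.toL2 u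
    (fun f C hA hJ => G.exists_subseq_cauchySeq_toL2 hconn hL hGL f hA hJ)
    (fun f hA hJ => G.exists_tendsto_of_cauchySeq hconn hL hGL f hA hJ) hne
  have hweak := weak_equation_of_minimizer G.derivL2 G.toL2 u g hAu hJu hg0 hg1 hmin
  have hgne : g ≠ 0 := by
    rintro rfl
    simp at hg1
  refine ⟨‖G.derivL2 g‖ ^ 2, ⟨⟨![u, g], ?_, ?_⟩, ?_⟩, ?_⟩
  · refine LinearIndependent.pair_iff.2 fun s t hst => ?_
    have hst' : s • u + t • g = 0 := Subtype.ext hst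
    have hs : s = 0 := by
      have := congrArg (fun w => inner ℝ (G.toL2 u) (G.toL2 w)) hst'
      simp only [map_add, map_smul, inner_add_right, inner_smul_right, hg0, map_zero,
        inner_zero_right, mul_zero, add_zero, mul_eq_zero, inner_self_eq_zero] at this
      exact this.resolve_right hJu
    subst hs
    rw [zero_smul, zero_add, smul_eq_zero] at hst'
    exact ⟨rfl, hst'.resolve_right hgne⟩
  · refine Fin.forall_fin_two.2 ⟨⟨0, by positivity, ?_⟩, ⟨_, le_rfl, ?_⟩⟩
    · refine (G.isNeumannEigenfunction_iff 0 u).2 ⟨hu0, fun v => ?_⟩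
      rw [hAu, inner_zero_left, zero_mul]
    · exact (G.isNeumannEigenfunction_iff _ g).2 ⟨hgne, hweak⟩
  · rintro t ⟨ψ, hψ, hν⟩
    choose ν hνt hν using hν
    obtain ⟨f, rfl⟩ : ∃ f : Fin 2 → G.H1, ψ = fun i => (f i : G.Pt → ℝ) :=
      ⟨fun i => ⟨ψ i, (hν i).2.1⟩, rfl⟩
    have heq := fun i => (G.isNeumannEigenfunction_iff (ν i) (f i)).1 (hν i)
    have hself : ∀ i, ‖G.derivL2 (f i)‖ ^ 2 = ν i * ‖G.toL2 (f i)‖ ^ 2 := by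
      intro i
      rw [← real_inner_self_eq_norm_sq, ← real_inner_self_eq_norm_sq]
      exact (heq i).2 (f i)
    -- An eigenfunction orthogonal to `u` is itself a competitor. Otherwise testing against `u`
    -- forces both eigenvalues to vanish, and a combination orthogonal to `u` has zero energy, so
    -- the minimum is zero.
    by_cases hz : ∃ i, inner ℝ (G.toL2 u) (G.toL2 (f i)) = 0
    · obtain ⟨i, hi⟩ := hz
      have h1 := hmin (f i) hi
      rw [hself] at h1
      have h2 : 0 < ‖G.toL2 (f i)‖ := norm_pos_iff.2 fun h =>
        (heq i).1 (G.eq_zero_of_toL2_eq_zero h)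
      exact (le_of_mul_le_mul_right h1 (by positivity)).trans (hνt i)
    · push Not at hz
      have hν0 : ∀ i, ν i = 0 := by
        intro i
        have := (heq i).2 u
        rw [hAu, inner_zero_right, real_inner_comm] at this
        exact (mul_eq_zero.1 this.symm).resolve_right (hz i)
      have hA0 : ∀ i, G.derivL2 (f i) = 0 := by
        intro i
        have := hself i
        rw [hν0, zero_mul] at this
        exact norm_eq_zero.1 (pow_eq_zero_iff two_ne_zero |>.1 this)
      set w : G.H1 := inner ℝ (G.toL2 u) (G.toL2 (f 1)) • f 0 +
        (-inner ℝ (G.toL2 u) (G.toL2 (f 0))) • f 1 with hw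
      have hw0 : w ≠ 0 := by
        intro h
        have hli := LinearIndependent.pair_iff.1
          (show LinearIndependent ℝ ![(f 0 : G.Pt → ℝ), (f 1 : G.Pt → ℝ)] by
            convert hψ using 1
            ext i
            fin_cases i <;> rfl)
        have h' := congrArg Subtype.val h
        exact hz 1 (hli _ _ h').1
      have hwA : G.derivL2 w = 0 := by
        rw [hw, map_add, map_smul, map_smul, hA0, hA0, smul_zero, smul_zero, add_zero]
      have h1 := hmin w (by
        rw [hw, map_add, map_smul, map_smul, inner_add_right, inner_smul_right, inner_smul_right]
        ring)
      rw [hwA, norm_zero] at h1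
      have h2 : 0 < ‖G.toL2 w‖ := norm_pos_iff.2 fun h => hw0 (G.eq_zero_of_toL2_eq_zero h)
      have h3 := hνt 0
      rw [hν0] at h3
      refine le_trans ?_ h3
      exact le_of_mul_le_mul_right (h1.trans_eq (by simp)) (pow_pos h2 2)
  · intro Λ w₁ w₂ hA hJ h₁ h₂ hΛ₁ hΛ₂
    obtain ⟨w, hw, hw0, hwΛ⟩ :=
      exists_orthogonal_combination G.derivL2 G.toL2 u w₁ w₂ hA hJ h₁ h₂ hΛ₁ hΛ₂
    exact le_of_mul_le_mul_right ((hmin w hw).trans hwΛ) (pow_pos (norm_pos_iff.2 hw0) 2)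

end MetricGraph

/-! ### The one-dimensional cosine profile -/

/-- A quarter period of the cosine, extended by a constant: it is `cos (π t / d)` for `t ≤ d / 2`
and `0` for `t ≥ d / 2`. -/
noncomputable def cosBump (d t : ℝ) : ℝ := Real.cos (Real.pi / d * min t (d / 2))

theorem cosBump_of_le {d t : ℝ} (h : t ≤ d / 2) : cosBump d t = Real.cos (Real.pi / d * t) := by
  rw [cosBump, min_eq_left h]

theorem cosBump_of_ge {d t : ℝ} (hd : 0 < d) (h : d / 2 ≤ t) : cosBump d t = 0 := by
  rw [cosBump, min_eq_right h, show Real.pi / d * (d / 2) = Real.pi / 2 by field_simp,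
    Real.cos_pi_div_two]

theorem cosBump_nonneg {d t : ℝ} (hd : 0 < d) (h : 0 ≤ t) : 0 ≤ cosBump d t := by
  have hm : 0 ≤ min t (d / 2) := le_min h (by positivity)
  refine Real.cos_nonneg_of_neg_pi_div_two_le_of_le ?_ ?_
  · have : 0 ≤ Real.pi / d * min t (d / 2) := by positivity
    linarith [Real.pi_pos]
  · calc Real.pi / d * min t (d / 2) ≤ Real.pi / d * (d / 2) := by
          gcongr
          exact min_le_right _ _
      _ = Real.pi / 2 := by field_simp

theorem abs_cosBump_le_one (d t : ℝ) : |cosBump d t| ≤ 1 := Real.abs_cos_le_one _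

theorem abs_cos_sub_cos_le_abs_sin_mul (a b : ℝ) :
    |Real.cos a - Real.cos b| ≤ |Real.sin ((a + b) / 2)| * |a - b| := by
  rw [Real.cos_sub_cos, abs_mul, abs_mul, abs_neg, abs_two]
  have h : |Real.sin ((a - b) / 2)| ≤ |(a - b) / 2| := Real.abs_sin_le_abs
  rw [abs_div, abs_two] at h
  nlinarith [abs_nonneg (Real.sin ((a + b) / 2))]

theorem lipschitzWith_cosBump {d : ℝ} (hd : 0 < d) :
    LipschitzWith (Real.toNNReal (Real.pi / d)) (cosBump d) := by
  have hp : 0 ≤ Real.pi / d := by positivity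
  refine LipschitzWith.of_dist_le_mul fun s t => ?_
  rw [Real.dist_eq, Real.dist_eq, Real.coe_toNNReal _ hp]
  refine (abs_cos_sub_cos_le_abs_sin_mul _ _).trans ?_
  rw [← mul_sub, abs_mul, abs_of_nonneg hp]
  calc _ ≤ 1 * (Real.pi / d * |min s (d / 2) - min t (d / 2)|) := by
        gcongr
        exact Real.abs_sin_le_one _
    _ ≤ Real.pi / d * |s - t| := by
        rw [one_mul]
        refine mul_le_mul_of_nonneg_left ((abs_min_sub_min_le_max s (d / 2) t (d / 2)).trans_eq ?_)
          hp
        rw [sub_self, abs_zero, max_eq_left (abs_nonneg _)]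

/-- The chain rule bound `(π / d)² sin²`, rewritten by `sin² = 1 - cos²`, but valid at every point
even if `r` is not differentiable. Where `r z ≥ d / 2` the composition has a minimum, so `deriv` is
zero. -/
theorem sq_deriv_cosBump_comp_le {d : ℝ} (hd : 0 < d) {r : ℝ → ℝ} (hr : LipschitzWith 1 r)
    (hr0 : ∀ z, 0 ≤ r z) (z : ℝ) :
    deriv (fun y => cosBump d (r y)) z ^ 2 ≤
      (Real.pi / d) ^ 2 * ((Iio (d / 2)).indicator 1 (r z) - cosBump d (r z) ^ 2) := by
  have hp : 0 ≤ Real.pi / d := by positivity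
  rcases le_or_gt (d / 2) (r z) with h | h
  · have hmin : IsLocalMin (fun y => cosBump d (r y)) z :=
      .of_forall fun y => by
        simp only [cosBump_of_ge hd h]
        exact cosBump_nonneg hd (hr0 y)
    rw [hmin.deriv_eq_zero, cosBump_of_ge hd h, indicator_of_notMem (by simpa using h)]
    simp
  · rw [indicator_of_mem (by simpa using h), Pi.one_apply, cosBump_of_le h.le, ← Real.sin_sq,
      ← mul_pow, ← sq_abs]
    refine pow_le_pow_left₀ (abs_nonneg _) ?_ 2 |>.trans_eq (sq_abs _)
    rw [abs_mul, abs_of_nonneg hp]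
    -- Any `C` above the target is a Lipschitz constant at `z`: by sum-to-product, difference
    -- quotients are at most `π / d` times `|sin|` at the mean argument, which is continuous.
    refine le_of_forall_gt_imp_ge_of_dense fun C hC => ?_
    have hC0 : 0 ≤ C := le_trans (by positivity) hC.le
    rw [← Real.norm_eq_abs]
    refine norm_deriv_le_of_lip' hC0 ?_
    have hcont := hr.continuous
    have hcoef : Continuous fun y =>
        Real.pi / d * |Real.sin ((Real.pi / d * r y + Real.pi / d * r z) / 2)| := by fun_prop
    have h1 := hcoef.continuousAt (x := z) |>.eventually (gt_mem_nhds (a := C) (by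
      simp only [add_self_div_two]
      exact hC))
    have h2 := hcont.continuousAt (x := z) |>.eventually (gt_mem_nhds h)
    filter_upwards [h1, h2] with y hy1 hy2
    rw [cosBump_of_le hy2.le, cosBump_of_le h.le, Real.norm_eq_abs, Real.norm_eq_abs]
    refine (abs_cos_sub_cos_le_abs_sin_mul _ _).trans ?_
    have h3 : |r y - r z| ≤ |y - z| := by
      simpa [Real.dist_eq] using hr.dist_le_mul y z
    rw [← mul_sub, abs_mul, abs_of_nonneg hp]
    calc _ ≤ |Real.sin ((Real.pi / d * r y + Real.pi / d * r z) / 2)| *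
          (Real.pi / d * |y - z|) := by gcongr
      _ = Real.pi / d * |Real.sin ((Real.pi / d * r y + Real.pi / d * r z) / 2)| * |y - z| := by
        ring
      _ ≤ C * |y - z| := by gcongr

theorem setLIntegral_sq_cosBump {d : ℝ} (hd : 0 < d) :
    ENNReal.ofReal (d / 4) ≤ ∫⁻ t in Icc 0 d, ENNReal.ofReal (cosBump d t ^ 2) := by
  have hcont : Continuous fun t => cosBump d t ^ 2 := (lipschitzWith_cosBump hd).continuous.pow 2
  have hsub : Icc 0 (d / 2) ⊆ Icc 0 d := Icc_subset_Icc_right (by linarith)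
  refine le_trans ?_ (lintegral_mono_set hsub)
  rw [← ofReal_integral_eq_lintegral_ofReal hcont.integrableOn_Icc
    (.of_forall fun t => sq_nonneg _)]
  refine ENNReal.ofReal_le_ofReal (le_of_eq ?_)
  rw [integral_Icc_eq_integral_Ioc, ← intervalIntegral.integral_of_le (by positivity)]
  have h1 : ∫ t in (0 : ℝ)..d / 2, cosBump d t ^ 2 =
      ∫ t in (0 : ℝ)..d / 2, Real.cos (Real.pi / d * t) ^ 2 := by
    refine intervalIntegral.integral_congr fun t ht => ?_
    rw [uIcc_of_le (by positivity)] at ht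
    simp only [cosBump_of_le ht.2]
  rw [h1, intervalIntegral.integral_comp_mul_left (fun t => Real.cos t ^ 2) (by positivity),
    integral_cos_sq, show Real.pi / d * (d / 2) = Real.pi / 2 by field_simp]
  simp only [Real.cos_pi_div_two, mul_zero, Real.sin_zero, smul_eq_mul]
  field_simp
  norm_num [mul_comm]

/-! ### Test functions on the graph: mass, energy, orthogonality -/

namespace MetricGraph

variable {E : Type*} (G : MetricGraph E)

/-- The distance to the point `x` as a real number. -/
noncomputable def distTo (x p : G.Pt) : ℝ := (edist p x).toReal

theorem distTo_nonneg (x p : G.Pt) : 0 ≤ G.distTo x p := ENNReal.toReal_nonneg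

theorem lipschitzWith_distTo (hconn : G.Connected) (x : G.Pt) : LipschitzWith 1 (G.distTo x) := by
  let _ := PseudoEMetricSpace.toPseudoMetricSpace fun p q : G.Pt => (hconn p q).ne
  exact LipschitzWith.dist_left x

theorem lipschitzWith_onEdge_distTo (hconn : G.Connected) (x : G.Pt) (e : E) :
    LipschitzWith 1 (G.onEdge (G.distTo x) e) := by
  have h := (G.lipschitzWith_distTo hconn x).comp (LipschitzWith.of_edist_le (G.edist_pt_le e))
  rwa [mul_one] at h

theorem le_distTo_add_distTo (hconn : G.Connected) (x y p : G.Pt) :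
    G.distTo x y ≤ G.distTo x p + G.distTo y p := by
  simp only [distTo]
  rw [← ENNReal.toReal_add (hconn p x).ne (hconn p y).ne, edist_comm p y, add_comm]
  exact ENNReal.toReal_mono (ENNReal.add_ne_top.2 ⟨(hconn y p).ne, (hconn p x).ne⟩)
    (edist_triangle y p x)

/-- The test function `cosBump d` of the distance to `x`. -/
noncomputable def testFun (d : ℝ) (x p : G.Pt) : ℝ := cosBump d (G.distTo x p)

theorem sq_dlift_testFun_le (hconn : G.Connected) {d : ℝ} (hd : 0 < d) (x : G.Pt)
    (a : (_ : E) × ℝ) : G.dlift (G.testFun d x) a ^ 2 ≤ (Real.pi / d) ^ 2 *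
      ((Iio (d / 2)).indicator 1 (G.lift (G.distTo x) a) - G.lift (G.testFun d x) a ^ 2) :=
  sq_deriv_cosBump_comp_le hd (G.lipschitzWith_onEdge_distTo hconn x a.1)
    (fun _ => G.distTo_nonneg x _) a.2

theorem memH1_testFun [Countable E] (hconn : G.Connected) {L : ℝ}
    (hGL : G.totalLength = ENNReal.ofReal L) {d : ℝ} (hd : 0 < d) (x : G.Pt) :
    G.MemH1 (G.testFun d x) := by
  have : IsFiniteMeasure G.meas := ⟨by rw [meas_univ, hGL]; exact ENNReal.ofReal_lt_top⟩
  have hc : Continuous (G.testFun d x) :=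
    (lipschitzWith_cosBump hd).continuous.comp (G.lipschitzWith_distTo hconn x).continuous
  have hlip : ∀ e, LipschitzWith _ (G.onEdge (G.testFun d x) e) := fun e =>
    (lipschitzWith_cosBump hd).comp (G.lipschitzWith_onEdge_distTo hconn x e)
  refine G.memH1_iff.2 ⟨hc, fun e => (hlip e).lipschitzOnWith.absolutelyContinuousOnInterval,
    MemLp.of_bound (G.aestronglyMeasurable_lift hc) 1 (.of_forall fun a => abs_cosBump_le_one _ _),
    MemLp.of_bound (G.aestronglyMeasurable_dlift _) _
      (.of_forall fun a => norm_deriv_le_of_lipschitz (hlip a.1))⟩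

theorem half_le_measure_ball [Countable E] (hconn : G.Connected) (x y : G.Pt)
    (hd : 0 < G.distTo x y) : ENNReal.ofReal (G.distTo x y / 2) ≤
      G.meas (G.lift (G.distTo x) ⁻¹' Iio (G.distTo x y / 2)) := by
  set d := G.distTo x y
  have h := G.volume_restrict_le_map_lift hconn (G.lipschitzWith_distTo hconn x).continuous
    (G.lipschitzWith_onEdge_distTo hconn x) x y
  have h1 := h (Iio (d / 2))
  have h0 : G.distTo x x = 0 := by simp [distTo]
  rw [Measure.map_apply_of_aemeasurable (G.aestronglyMeasurable_lift
    (G.lipschitzWith_distTo hconn x).continuous).aemeasurable measurableSet_Iio,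
    Measure.restrict_apply measurableSet_Iio, h0, uIcc_of_le hd.le] at h1
  refine le_trans ?_ h1
  have : Ico 0 (d / 2) ⊆ Iio (d / 2) ∩ Icc 0 d := fun t ht =>
    ⟨ht.2, ht.1, ht.2.le.trans (by linarith)⟩
  refine le_trans ?_ (measure_mono this)
  rw [Real.volume_Ico, sub_zero]

theorem le_integral_sq_testFun [Countable E] (hconn : G.Connected) {L : ℝ}
    (hGL : G.totalLength = ENNReal.ofReal L) (x y : G.Pt) (hd : 0 < G.distTo x y) :
    G.distTo x y / 4 ≤ ∫ a, G.lift (G.testFun (G.distTo x y) x) a ^ 2 ∂G.meas := by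
  set d := G.distTo x y
  have hm := G.memH1_iff.1 (G.memH1_testFun hconn hGL hd x)
  have hρ := (G.aestronglyMeasurable_lift (G.lipschitzWith_distTo hconn x).continuous).aemeasurable
  have h := G.volume_restrict_le_map_lift hconn (G.lipschitzWith_distTo hconn x).continuous
    (G.lipschitzWith_onEdge_distTo hconn x) x y
  have h0 : G.distTo x x = 0 := by simp [distTo]
  rw [h0, uIcc_of_le hd.le] at h
  have hcont : Continuous fun t => ENNReal.ofReal (cosBump d t ^ 2) :=
    ENNReal.continuous_ofReal.comp ((lipschitzWith_cosBump hd).continuous.pow 2)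
  have h1 := (setLIntegral_sq_cosBump hd).trans (lintegral_mono' h le_rfl)
  rw [lintegral_map' hcont.measurable.aemeasurable hρ] at h1
  change _ ≤ ∫⁻ a, ENNReal.ofReal (G.lift (G.testFun d x) a ^ 2) ∂G.meas at h1
  rw [← ofReal_integral_eq_lintegral_ofReal hm.2.2.1.integrable_sq
    (.of_forall fun _ => sq_nonneg _)] at h1
  exact (ENNReal.ofReal_le_ofReal_iff (integral_nonneg fun _ => sq_nonneg _)).1 h1

/-- The ball about `y` is disjoint from this one by the triangle inequality and already takes length
`d / 2`. -/
theorem measureReal_ball_le [Countable E] (hconn : G.Connected) {L : ℝ} (hL : 0 < L)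
    (hGL : G.totalLength = ENNReal.ofReal L) (x y : G.Pt) (hd : 0 < G.distTo x y) :
    G.meas.real (G.lift (G.distTo x) ⁻¹' Iio (G.distTo x y / 2)) ≤ L - G.distTo x y / 2 := by
  have : IsFiniteMeasure G.meas := ⟨by rw [meas_univ, hGL]; exact ENNReal.ofReal_lt_top⟩
  have hsymm : G.distTo y x = G.distTo x y := by simp only [distTo, edist_comm]
  have h1 := G.half_le_measure_ball hconn y x (hsymm ▸ hd)
  rw [hsymm] at h1
  set d := G.distTo x y
  have hd' : Disjoint (G.lift (G.distTo x) ⁻¹' Iio (d / 2))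
      (G.lift (G.distTo y) ⁻¹' Iio (d / 2)) := by
    refine Set.disjoint_left.2 fun a ha hb => ?_
    have := G.le_distTo_add_distTo hconn x y (G.pt a.1 a.2)
    simp only [mem_preimage, mem_Iio, lift, onEdge] at ha hb
    linarith
  have hnull : NullMeasurableSet (G.lift (G.distTo y) ⁻¹' Iio (d / 2)) G.meas :=
    (G.aestronglyMeasurable_lift
      (G.lipschitzWith_distTo hconn y).continuous).aemeasurable.nullMeasurable measurableSet_Iio
  have h2 : G.meas.real _ = _ := measureReal_union₀ hnull hd'.aedisjoint
  have h3 : G.meas.real univ = L := by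
    rw [Measure.real, meas_univ, hGL, ENNReal.toReal_ofReal hL.le]
  have h4 := measureReal_mono (μ := G.meas) (subset_univ
    (G.lift (G.distTo x) ⁻¹' Iio (d / 2) ∪ G.lift (G.distTo y) ⁻¹' Iio (d / 2)))
  have h5 : d / 2 ≤ G.meas.real (G.lift (G.distTo y) ⁻¹' Iio (d / 2)) :=
    (ENNReal.ofReal_le_iff_le_toReal (measure_ne_top _ _)).1 h1
  linarith

/-- The test function as an element of `H¹`. -/
noncomputable def testH1 [Countable E] (hconn : G.Connected) {L : ℝ}
    (hGL : G.totalLength = ENNReal.ofReal L) {d : ℝ} (hd : 0 < d) (x : G.Pt) : G.H1 :=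
  ⟨G.testFun d x, G.memH1_testFun hconn hGL hd x⟩

theorem norm_sq_toL2 [Countable E] (f : G.H1) :
    ‖G.toL2 f‖ ^ 2 = ∫ a, G.lift f a ^ 2 ∂G.meas := by
  have hf := (G.memH1_iff.1 f.2).2.2.1
  rw [← real_inner_self_eq_norm_sq]
  exact (inner_toLp hf hf).trans (by simp only [sq])

theorem norm_sq_derivL2 [Countable E] (f : G.H1) :
    ‖G.derivL2 f‖ ^ 2 = ∫ a, G.dlift f a ^ 2 ∂G.meas := by
  have hf := (G.memH1_iff.1 f.2).2.2.2
  rw [← real_inner_self_eq_norm_sq]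
  exact (inner_toLp hf hf).trans (by simp only [sq])

theorem le_norm_sq_toL2_testH1 [Countable E] (hconn : G.Connected) {L : ℝ}
    (hGL : G.totalLength = ENNReal.ofReal L) (x y : G.Pt) (hd : 0 < G.distTo x y) :
    G.distTo x y / 4 ≤ ‖G.toL2 (G.testH1 hconn hGL hd x)‖ ^ 2 := by
  rw [norm_sq_toL2]
  exact G.le_integral_sq_testFun hconn hGL x y hd

theorem norm_sq_derivL2_testH1_le [Countable E] (hconn : G.Connected) {L : ℝ} (hL : 0 < L)
    (hGL : G.totalLength = ENNReal.ofReal L) (x y : G.Pt) (hd : 0 < G.distTo x y) :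
    ‖G.derivL2 (G.testH1 hconn hGL hd x)‖ ^ 2 ≤
      Real.pi ^ 2 / G.distTo x y ^ 2 * ((4 * L - 3 * G.distTo x y) / G.distTo x y) *
        ‖G.toL2 (G.testH1 hconn hGL hd x)‖ ^ 2 := by
  have : IsFiniteMeasure G.meas := ⟨by rw [meas_univ, hGL]; exact ENNReal.ofReal_lt_top⟩
  have hc := G.le_norm_sq_toL2_testH1 hconn hGL x y hd
  have hb := G.measureReal_ball_le hconn hL hGL x y hd
  have hm := G.memH1_iff.1 (G.memH1_testFun hconn hGL hd x)
  have hJ := G.norm_sq_toL2 (G.testH1 hconn hGL hd x)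
  have hA := G.norm_sq_derivL2 (G.testH1 hconn hGL hd x)
  have hnull : NullMeasurableSet (G.lift (G.distTo x) ⁻¹' Iio (G.distTo x y / 2)) G.meas :=
    (G.aestronglyMeasurable_lift
      (G.lipschitzWith_distTo hconn x).continuous).aemeasurable.nullMeasurable measurableSet_Iio
  set d := G.distTo x y
  set c := ‖G.toL2 (G.testH1 hconn hGL hd x)‖ ^ 2
  set S := G.lift (G.distTo x) ⁻¹' Iio (d / 2)
  have hint : Integrable (S.indicator (1 : (_ : E) × ℝ → ℝ)) G.meas :=
    (integrable_const (1 : ℝ)).indicator₀ hnull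
  have h1 : ∫ a, G.dlift (G.testFun d x) a ^ 2 ∂G.meas ≤
      ∫ a, (Real.pi / d) ^ 2 * (S.indicator 1 a - G.lift (G.testFun d x) a ^ 2) ∂G.meas :=
    integral_mono hm.2.2.2.integrable_sq ((hint.sub hm.2.2.1.integrable_sq).const_mul _)
      fun a => G.sq_dlift_testFun_le hconn hd x a
  rw [integral_const_mul, integral_sub hint hm.2.2.1.integrable_sq, integral_indicator₀ hnull] at h1
  have h2 : ∫ a in S, (1 : (_ : E) × ℝ → ℝ) a ∂G.meas = G.meas.real S := by simp
  have hJ' : ∫ a, G.lift (G.testFun d x) a ^ 2 ∂G.meas = c := hJ.symm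
  rw [h2, hJ'] at h1
  rw [hA]
  refine h1.trans ?_
  have h0 : 0 ≤ G.meas.real S := measureReal_nonneg
  rw [div_pow, mul_assoc]
  refine mul_le_mul_of_nonneg_left ?_ (by positivity)
  rw [div_mul_eq_mul_div, le_div_iff₀ hd]
  -- `|S| d ≤ (L - d / 2) d ≤ (L - d / 2) 4c`; subtracting `c d` leaves `(4 L - 3 d) c`.
  nlinarith [mul_nonneg (show 0 ≤ L - d / 2 by linarith) (show 0 ≤ 4 * c - d by linarith)]

/-- No point is within `d / 2` of both centres, so at each point one of the functions vanishes, and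
its `deriv` too by the pointwise energy bound. -/
theorem testH1_orthogonal [Countable E] (hconn : G.Connected) {L : ℝ}
    (hGL : G.totalLength = ENNReal.ofReal L) (x y : G.Pt) {d : ℝ} (hd : 0 < d)
    (hxy : d ≤ G.distTo x y) :
    inner ℝ (G.derivL2 (G.testH1 hconn hGL hd x)) (G.derivL2 (G.testH1 hconn hGL hd y)) = 0 ∧
    inner ℝ (G.toL2 (G.testH1 hconn hGL hd x)) (G.toL2 (G.testH1 hconn hGL hd y)) = 0 := by
  have hx := G.memH1_iff.1 (G.memH1_testFun hconn hGL hd x)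
  have hy := G.memH1_iff.1 (G.memH1_testFun hconn hGL hd y)
  have hfar : ∀ a, d / 2 ≤ G.lift (G.distTo x) a ∨ d / 2 ≤ G.lift (G.distTo y) a := by
    intro a
    by_contra! hcon
    have := G.le_distTo_add_distTo hconn x y (G.pt a.1 a.2)
    simp only [lift, onEdge] at hcon
    linarith
  have hJ0 : ∀ z a, d / 2 ≤ G.lift (G.distTo z) a → G.lift (G.testFun d z) a = 0 :=
    fun z a h => cosBump_of_ge hd h
  have hA0 : ∀ z a, d / 2 ≤ G.lift (G.distTo z) a → G.dlift (G.testFun d z) a = 0 := by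
    intro z a h
    have := G.sq_dlift_testFun_le hconn hd z a
    rw [hJ0 z a h, indicator_of_notMem (by simpa using h)] at this
    exact pow_eq_zero_iff two_ne_zero |>.1 (le_antisymm (by simpa using this) (sq_nonneg _))
  constructor
  · refine (inner_toLp hx.2.2.2 hy.2.2.2).trans (integral_eq_zero_of_ae (.of_forall fun a => ?_))
    rcases hfar a with h | h <;> simp [hA0 _ a h]
  · refine (inner_toLp hx.2.2.1 hy.2.2.1).trans (integral_eq_zero_of_ae (.of_forall fun a => ?_))
    rcases hfar a with h | h <;> simp [hJ0 _ a h]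

end MetricGraph

/-! ### Conclusion: from distances to the diameter -/

theorem mainTheorem9 {E : Type*} [Countable E] (G : MetricGraph E)
    (hfin : G.LocallyFinite) (hconn : G.Connected)
    (L D : ℝ) (hL : 0 < L) (hGL : G.totalLength = ENNReal.ofReal L)
    (hD : 0 < D) (hGD : G.diam = ENNReal.ofReal D)
    (β : ℕ) (hβ : G.betti = β) :
    ∃ μ₂ : ℝ, G.IsNeumannEigenvalue 2 μ₂ ∧
      μ₂ ≤ Real.pi ^ 2 / D ^ 2 * ((4 * L - 3 * D) / D) := by
  -- The diameter is a supremum that need not be attained, so pairs with distance close to `D` are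
  -- used.
  have hpair : ∀ c < D, 0 ≤ c → ∃ x y, c < G.distTo x y ∧ G.distTo x y ≤ D := by
    intro c hc hc0
    have h : ENNReal.ofReal c < ⨆ (p : G.Pt) (q : G.Pt), edist p q := by
      rw [← MetricGraph.diam, hGD]
      exact (ENNReal.ofReal_lt_ofReal_iff hD).2 hc
    obtain ⟨p, hp⟩ := lt_iSup_iff.1 h
    obtain ⟨q, hq⟩ := lt_iSup_iff.1 hp
    refine ⟨q, p, (ENNReal.ofReal_lt_iff_lt_toReal hc0 (hconn p q).ne).1 hq, ?_⟩
    refine ENNReal.toReal_le_of_le_ofReal hD.le ?_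
    rw [← hGD]
    exact le_iSup₂ (f := fun p q : G.Pt => edist p q) p q
  have htest : ∀ x y (hd : 0 < G.distTo x y), ∃ w₁ w₂ : G.H1,
      inner ℝ (G.derivL2 w₁) (G.derivL2 w₂) = 0 ∧ inner ℝ (G.toL2 w₁) (G.toL2 w₂) = 0 ∧
      G.toL2 w₁ ≠ 0 ∧ G.toL2 w₂ ≠ 0 ∧
      ‖G.derivL2 w₁‖ ^ 2 ≤ Real.pi ^ 2 / G.distTo x y ^ 2 *
        ((4 * L - 3 * G.distTo x y) / G.distTo x y) * ‖G.toL2 w₁‖ ^ 2 ∧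
      ‖G.derivL2 w₂‖ ^ 2 ≤ Real.pi ^ 2 / G.distTo x y ^ 2 *
        ((4 * L - 3 * G.distTo x y) / G.distTo x y) * ‖G.toL2 w₂‖ ^ 2 := by
    intro x y hd
    have hne : ∀ x y (hd : 0 < G.distTo x y), G.toL2 (G.testH1 hconn hGL hd x) ≠ 0 := by
      intro x y hd h
      have := G.le_norm_sq_toL2_testH1 hconn hGL x y hd
      rw [h, norm_zero] at this
      linarith
    have hsymm : G.distTo y x = G.distTo x y := by simp only [MetricGraph.distTo, edist_comm]
    -- Positivity of the distance stays quantified here, so that `hsymm` can rewrite inside the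
    -- dependent test function.
    have hy1 := hne y x
    have hy2 := G.norm_sq_derivL2_testH1_le hconn hL hGL y x
    rw [hsymm] at hy1 hy2
    have ho := G.testH1_orthogonal hconn hGL x y hd le_rfl
    exact ⟨_, _, ho.1, ho.2, hne x y hd, hy1 hd,
      G.norm_sq_derivL2_testH1_le hconn hL hGL x y hd, hy2 hd⟩
  obtain ⟨μ, hμ, hbound⟩ := G.exists_isNeumannEigenvalue_two hconn hL hGL (by
    obtain ⟨x, y, hxy, -⟩ := hpair 0 hD le_rfl
    obtain ⟨w₁, w₂, h1, h2, h3, h4, -⟩ := htest x y hxy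
    exact ⟨w₁, w₂, h1, h2, h3, h4⟩)
  refine ⟨μ, hμ, ?_⟩
  by_contra! hcon
  -- If the bound failed at `D`, by continuity it would fail for all `d ≤ D` near `D`, including
  -- some realized distance, where `hbound` proves it.
  have hF : ContinuousAt (fun d : ℝ => Real.pi ^ 2 / d ^ 2 * ((4 * L - 3 * d) / d)) D := by
    fun_prop (disch := positivity)
  have hev := hF.eventually (gt_mem_nhds hcon)
  obtain ⟨c, hc, hsub⟩ := exists_Ioc_subset_of_mem_nhds hev ⟨0, hD⟩
  obtain ⟨x, y, hxy, hle⟩ := hpair (max c 0) (max_lt hc hD) (le_max_right _ _)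
  have hlt := hsub ⟨(le_max_left _ _).trans_lt hxy, hle⟩
  obtain ⟨w₁, w₂, h1, h2, h3, h4, h5, h6⟩ := htest x y ((le_max_right _ _).trans_lt hxy)
  exact absurd (hbound _ w₁ w₂ h1 h2 h3 h4 h5 h6) (not_le.2 hlt)
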